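/- Theorem 6.8. An increasing tableau is a filling of a Young diagram (English convention; rows and columns numbered from $1$) with positive integers, strictly increasing along rows and down columns. A cell $(r,c)$ of $P$ is outer if neither $(r+1,c)$ nor $(r,c+1)$ is a cell of $P$. *Left key.* Let $P$ be an increasing tableau with $r$ rows and largest entry $N$. For each column index $j$ of $P$, column $j$ of the left key, the set $K_-(P)_j$, is defined as follows. Restrict $P$ to its first $j$ columns, inside the rectangle with $r$ rows and $j$ columns. As long as the outer shape is not the whole rectangle, add to it one cell containing $\bullet$, at the leftmost position in the rectangle at which a cell can be added; then for $m=N,N-1,\dots,1$ in turn perform the reverse K-jeu-de-taquin move for $m$, which simultaneously replaces every $\bullet$ adjacent (horizontally or vertically) to an $m$ by $m$ and every $m$ adjacent to a $\bullet$ by $\bullet$; then erase all $\bullet$ (the outer shape keeps the added cell). $K_-(P)_j$ is the set of numbers in the leftmost column of the rectangle at the end. If $j$ exceeds the number of columns of $P$, put $K_-(P)_j=\emptyset$. *Reverse row insertion (Huang–Shimozono–Yu).* A value $x$ is ejectable in a tableau $T$ if $x$ occurs in the first row of $T$ and either $x+1$ does not occur in the first row, or $x+1$ does and is ejectable in the tableau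 obtained from $T$ by removing its first row. The input is an increasing tableau $P$, an outer cell $(R,C)$ of $P$ and $\alpha\in\{0,1\}$. Put $c_R=C$ and, for $i=R-1,\dots,1$, let $c_i$ be the largest column with $P(i,c_i)<P(i+1,c_{i+1})$; put $m_i=P(i,c_i)$ for $i\le R$. Start with $P'=P$. If $\alpha=1$, remove the cell $(R,C)$ from $P'$, set $\alpha_R=1$ and start with $i=R-1$; if $\alpha=0$, set $m_{R+1}=\infty$, $\alpha_{R+1}=0$ and start with $i=R$. For $i$ decreasing to $1$: if $m_i+1$ is in row $i$ of $P'$, leave row $i$ unchanged and set $\alpha_i=\alpha_{i+1}$; otherwise, if $\alpha_{i+1}=1$ and $m_{i+1}$ is not in row $i$, replace $m_i$ by $m_{i+1}$ in row $i$ and set $\alpha_i=1$; otherwise, let $x$ be the largest value with $m_i<x<m_{i+1}$ that is ejectable in the tableau formed by the rows $i+1,i+2,\dots$ of $P'$; if $x$ exists, replace $m_i$ by $x$ in row $i$ and set $\alpha_i=1$; if not, leave row $i$ unchanged and set $\alpha_i=0$. The output is $(P',m)$ with $m=m_1$. *Statement.* Let $(P',m)$ be the output of reverse row insertion on an increasing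 tableau $P$ at an outer cell $(R,C)$ with flag $\alpha$. Then $P'$ is an increasing tableau, and: - if $\alpha=0$, then $K_-(P')_j=K_-(P)_j$ for all $j\ge 1$; - if $\alpha=1$, then $K_-(P')_j=K_-(P)_j$ for all $j\neq C$, the set $K_-(P)_C\setminus K_-(P)_{C+1}$ is non-empty, and $$K_-(P')_C=K_-(P)_C\setminus\{\min(K_-(P)_C\setminus K_-(P)_{C+1})\}.$$ -/

import Mathlib

/-- A filling of a Young diagram with natural numbers. Rows and columns are indexed from `0`;
`(i, c)` is the cell in row `i` and column `c`. Values of `entry` outside `shape` carry no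
meaning and are never read. -/
structure Tableau where
  shape : YoungDiagram
  entry : ℕ → ℕ → ℕ

namespace Tableau

/-- Increasing tableau: positive entries, rows and columns strictly increasing. -/
structure IsIncreasing (P : Tableau) : Prop where
  pos : ∀ i c, (i, c) ∈ P.shape → 0 < P.entry i c
  row_lt : ∀ i c c', c < c' → (i, c') ∈ P.shape → P.entry i c < P.entry i c'
  col_lt : ∀ i i' c, i < i' → (i', c) ∈ P.shape → P.entry i c < P.entry i' c

/-- Outer cell: a cell with no cell directly below it or directly to its right. -/
structure IsOuter (P : Tableau) (r c : ℕ) : Prop where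
  mem : (r, c) ∈ P.shape
  below : (r + 1, c) ∉ P.shape
  right : (r, c + 1) ∉ P.shape

/-- The set of numbers in row `i`. -/
def row (P : Tableau) (i : ℕ) : Set ℕ := {x | ∃ c, (i, c) ∈ P.shape ∧ P.entry i c = x}

/-! ### The left key, through K-theoretic jeu de taquin -/

/-- Content of a position in a dotted skew tableau: not in the shape, the symbol `•`,
or a number. -/
inductive DotEntry where
  | empty : DotEntry
  | dot : DotEntry
  | num : ℕ → DotEntry
deriving DecidableEq

/-- A (dotted) skew tableau, given by the content of every position. -/
abbrev DotFilling := ℕ → ℕ → DotEntry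

/-- Some position horizontally or vertically adjacent to `(i, c)` has content `e`. -/
def HasNeighbor (T : DotFilling) (i c : ℕ) (e : DotEntry) : Prop :=
  T (i + 1) c = e ∨ T i (c + 1) = e ∨ (0 < i ∧ T (i - 1) c = e) ∨ (0 < c ∧ T i (c - 1) = e)

instance (T : DotFilling) (i c : ℕ) (e : DotEntry) : Decidable (HasNeighbor T i c e) := by
  unfold HasNeighbor; infer_instance

/-- The reverse K-jeu-de-taquin move for the number `m`: simultaneously, every `•` adjacent to an
`m` becomes `m`, and every `m` adjacent to a `•` becomes `•`. -/
def revKjdt (m : ℕ) (T : DotFilling) : DotFilling := fun i c =>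
  if T i c = .dot ∧ HasNeighbor T i c (.num m) then .num m
  else if T i c = .num m ∧ HasNeighbor T i c .dot then .dot
  else T i c

/-- The moves for `m, m - 1, …, 1`, in this order. -/
def revKjdtAll : ℕ → DotFilling → DotFilling
  | 0, T => T
  | m + 1, T => revKjdtAll m (revKjdt (m + 1) T)

/-- Put a `•` at the position `p`. -/
def addDot (T : DotFilling) (p : ℕ × ℕ) : DotFilling := fun i c =>
  if (i, c) = p then .dot else T i c

/-- Remove all `•`. -/
def removeDots (T : DotFilling) : DotFilling := fun i c =>
  if T i c = .dot then .empty else T i c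

/-- One round of anti-rectification of a skew tableau with entries at most `m`: add a `•` at `p`,
perform the moves for `m, …, 1`, remove all `•`. -/
def antiRectifyRound (m : ℕ) (T : DotFilling) (p : ℕ × ℕ) : DotFilling :=
  removeDots (revKjdtAll m (addDot T p))

/-- The restriction of `P` to its columns `0, …, j`, as a skew tableau. -/
def firstColumns (P : Tableau) (j : ℕ) : DotFilling := fun i c =>
  if (i, c) ∈ P.shape ∧ c ≤ j then .num (P.entry i c) else .empty

/-- The number of rows. -/
def numRows (P : Tableau) : ℕ := P.shape.colLen 0

/-- The number of columns. -/
def numCols (P : Tableau) : ℕ := P.shape.rowLen 0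

/-- The largest entry (`0` for the empty tableau). -/
def maxEntry (P : Tableau) : ℕ := P.shape.cells.sup fun p => P.entry p.1 p.2

/-- The positions at which a `•` is placed, in order, when the first columns `0, …, j` of `P` are
anti-rectified inside the rectangle with `numRows P` rows and `j + 1` columns and the `•` is always
placed at the leftmost available position. The outer shape, to which each round adds the
position of its `•`, is at the start the shape of these columns. A column has an available
position (the one just below the outer shape) if it is not full and the column to its left
reaches further down. So the leftmost available position is the one in the first column that is
not full: the columns get filled one after the other from the left, each from top to bottom. -/
def dotPositions (P : Tableau) (j : ℕ) : List (ℕ × ℕ) :=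
  (List.range (j + 1)).flatMap fun c =>
    (List.range' (P.shape.colLen c) (P.numRows - P.shape.colLen c)).map fun i => (i, c)

/-- The anti-rectification of the first columns `0, …, j` of `P`. -/
def antiRectify (P : Tableau) (j : ℕ) : DotFilling :=
  (P.dotPositions j).foldl (antiRectifyRound P.maxEntry) (P.firstColumns j)

/-- The left key of `P`, given by its columns: `P.leftKey j` is the set of numbers in column `j`.
The left key has as many columns as `P`; further columns are empty. -/
def leftKey (P : Tableau) (j : ℕ) : Set ℕ :=
  {x | j < P.numCols ∧ ∃ i, P.antiRectify j i 0 = .num x}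

/-! ### Reverse row insertion -/

/-- `P.Ejectable i x`: the value `x` is ejectable in the tableau that consists of the rows
`i, i + 1, …` of `P`. -/
inductive Ejectable (P : Tableau) : ℕ → ℕ → Prop
  | last (i x : ℕ) : x ∈ P.row i → x + 1 ∉ P.row i → Ejectable P i x
  | next (i x : ℕ) : x ∈ P.row i → x + 1 ∈ P.row i → Ejectable P (i + 1) (x + 1) →
      Ejectable P i x

/-- Column of the cell in row `r - k` of the bumping path of `(r, c)` in `P` (for `k ≤ r`): it is
`c` for `k = 0`, and then the largest column where the entry of row `r - (k + 1)` is smaller than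
the entry of the path in the row below. -/
def pathColUp (P : Tableau) (r c : ℕ) : ℕ → ℕ
  | 0 => c
  | k + 1 => Nat.findGreatest
      (fun d => (r - (k + 1), d) ∈ P.shape ∧
        P.entry (r - (k + 1)) d < P.entry (r - k) (pathColUp P r c k))
      (P.shape.rowLen (r - (k + 1)))

/-- Column of the cell in row `i ≤ r` of the bumping path of `(r, c)`. -/
def pathCol (P : Tableau) (r c i : ℕ) : ℕ := P.pathColUp r c (r - i)

/-- The entry `m_i` of the bumping path of `(r, c)` in row `i`, with `m_{r + 1} = ∞`. -/
def pathVal (P : Tableau) (r c i : ℕ) : ℕ∞ :=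
  if i ≤ r then (P.entry i (P.pathCol r c i) : ℕ∞) else ⊤

/-- Remove an outer cell. -/
def removeCell (P : Tableau) (r c : ℕ) (h : P.IsOuter r c) : Tableau where
  shape :=
    { cells := P.shape.cells.erase (r, c)
      isLowerSet := by
        rintro ⟨a, b⟩ ⟨a', b'⟩ hle hab
        simp only [Finset.coe_erase, Set.mem_sdiff, Finset.mem_coe, YoungDiagram.mem_cells,
          Set.mem_singleton_iff] at hab ⊢
        obtain ⟨ha, hb⟩ := Prod.mk_le_mk.1 hle
        refine ⟨P.shape.up_left_mem ha hb hab.1, ?_⟩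
        rintro heq
        obtain ⟨rfl, rfl⟩ := Prod.mk.inj heq
        rcases ha.lt_or_eq with hlt | rfl
        · exact h.below (P.shape.up_left_mem hlt hb hab.1)
        · rcases hb.lt_or_eq with hlt | rfl
          · exact h.right (P.shape.up_left_mem le_rfl hlt hab.1)
          · exact hab.2 rfl }
  entry := P.entry

/-- Replace the entry of the cell `(i, c)` by `x`. -/
def setEntry (P : Tableau) (i c x : ℕ) : Tableau where
  shape := P.shape
  entry := Function.update P.entry i (Function.update (P.entry i) c x)

open Classical in
/-- The iteration in row `i` of the reverse row insertion on `P` at `(r, c)`. The state consists of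
the working tableau and the status indicator (`α_{i + 1}` before, `α_i` after). The four cases are,
in order: dummy, direct replacement, indirect replacement, no replacement. -/
noncomputable def reverseStep (P : Tableau) (r c i : ℕ) (s : Tableau × Bool) : Tableau × Bool :=
  let T := s.1
  let ci := P.pathCol r c i
  let m := P.entry i ci
  let m' := P.pathVal r c (i + 1)
  if m + 1 ∈ T.row i then (T, s.2)
  else if s.2 = true ∧ ∀ x ∈ T.row i, (x : ℕ∞) ≠ m' then (T.setEntry i ci m'.toNat, true)
  else if h : ∃ x, IsGreatest {x : ℕ | T.Ejectable (i + 1) x ∧ m < x ∧ (x : ℕ∞) < m'} x then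
    (T.setEntry i ci h.choose, true)
  else (T, false)

/-- The iterations in the rows `n - 1, …, 1, 0`, in this order. -/
noncomputable def reverseLoop (P : Tableau) (r c : ℕ) : ℕ → Tableau × Bool → Tableau × Bool
  | 0, s => s
  | n + 1, s => reverseLoop P r c n (reverseStep P r c n s)

/-- Reverse row insertion on `P` at the outer cell `(r, c)` with flag `α`. The output is the pair
`(P', m)`. For `α = 1` the cell is removed and the loop starts in the row above it; for `α = 0` the
loop starts in row `r`. -/
noncomputable def reverseInsert (P : Tableau) (r c : ℕ) (h : P.IsOuter r c) (α : Bool) :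
    Tableau × ℕ :=
  ((if α then reverseLoop P r c r (P.removeCell r c h, true)
    else reverseLoop P r c (r + 1) (P, false)).1,
   P.entry 0 (P.pathCol r c 0))

end Tableau

/-! A finite set of numbers is recorded by its counting function, the number of elements `≥ t`. If
elements of a set `A` are matched with strictly larger elements of a set with counting function `g`,
then for every cut `u ≥ t` at most `countIn A t u + g (u + 1)` elements of `A` in `[t, ∞)` find a
partner. The minimum over `u` is `slide A g t`, the counting function of the matched part of `A`
(Hall's theorem with deficiency). Matchings thus become comparisons of cuts.

`keyCount A j` slides column `j` through all columns to its left. `leftKey_eq` identifies it with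
column `j` of the left key. A reverse K-jeu-de-taquin move for `m` only adds `m` to some columns and
removes it from others, and the slides see neither change (`keyCount_eq_of_move`). In the final
rectangle each column is matched along the rows with the next one, so the slides reproduce the first
column.

It remains to follow `keyCount` while reverse insertion changes one entry per row. Away from the
removed cell, an inserted, removed or replaced number is invisible under a domination condition
between neighbouring columns (`keyCount_insert`, `keyCount_diff`, `keyCount_swap`). The conditions
may fail while the path runs straight up a column. The invariant `IsReverseState` therefore compares
the working columns both with and without the path entry, and `settled` shows that the difference
disappears once the row above is tight.

For `α = 1`, as long as the path stays in column `C`, that column has lost exactly one element `m`.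
When the path becomes tight, `m` is the least element of column `C` not matched with column `C + 1`.
By `tailCount_diff_eq_min` the remaining column is the minimum of two counting functions. Slides
commute with minima and constants, so the key column becomes `min (key C) (key (C + 1) + n)`, where
`n + 1` is the difference of the column sizes. By `isLeast_stepSet` this is the key column without
its least element outside the next one. -/

namespace Tableau

/-! ### Counting functions of sets of numbers and the slide operator -/

/-- The number of elements of `A` in `[a, b)`. -/
noncomputable def countIn (A : Set ℕ) (a b : ℕ) : ℕ := (A ∩ Set.Ico a b).ncard

/-- The number of elements of `A` that are at least `t`. -/
noncomputable def tailCount (A : Set ℕ) (t : ℕ) : ℕ := (A ∩ Set.Ici t).ncard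

/-- The counting function of the subset of `A` that is matched, from the right, with a set of
larger elements whose counting function is `g`. -/
noncomputable def slide (A : Set ℕ) (g : ℕ → ℕ) (t : ℕ) : ℕ :=
  ⨅ u : Set.Ici t, countIn A t u + g (u + 1)

/-- Slide `g` through the columns `A (c + k - 1), …, A c`, in this order. -/
noncomputable def slideAll (A : ℕ → Set ℕ) : ℕ → ℕ → (ℕ → ℕ) → ℕ → ℕ
  | _, 0, g => g
  | c, k + 1, g => slide (A c) (slideAll A (c + 1) k g)

/-- The counting function of the set obtained by sliding `A j` through `A (j - 1), …, A 0`. -/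
noncomputable def keyCount (A : ℕ → Set ℕ) (j : ℕ) : ℕ → ℕ :=
  slideAll A 0 j (tailCount (A j))

/-- The set with a given counting function. -/
def stepSet (g : ℕ → ℕ) : Set ℕ := {t | g (t + 1) < g t}

/-! ### Counting elements in intervals and tails -/

theorem countIn_add (A : Set ℕ) {a b c : ℕ} (hab : a ≤ b) (hbc : b ≤ c) :
    countIn A a b + countIn A b c = countIn A a c := by
  unfold countIn
  rw [← Set.ncard_union_eq _ ((Set.finite_Ico _ _).inter_of_right _)
    ((Set.finite_Ico _ _).inter_of_right _), ← Set.inter_union_distrib_left,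
    Set.Ico_union_Ico_eq_Ico hab hbc]
  rw [Set.disjoint_left]
  rintro x ⟨_, hx⟩ ⟨_, hy⟩
  exact absurd hx.2 (not_lt.2 hy.1)

theorem countIn_self (A : Set ℕ) (a : ℕ) : countIn A a a = 0 := by simp [countIn]

/-- Injections between columns come from neighbours in a common row. The row is only an existential
witness, so the matching is handled as a relation instead of a function. -/
theorem ncard_le_ncard_of_rel {S T : Set ℕ} (hT : T.Finite) (r : ℕ → ℕ → Prop)
    (h : ∀ x ∈ S, ∃ y ∈ T, r x y) (hinj : ∀ x x' y, r x y → r x' y → x = x') :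
    S.ncard ≤ T.ncard := by
  choose! f hf using h
  exact Set.ncard_le_ncard_of_injOn f (fun x hx => (hf x hx).1)
    (fun x hx y hy hxy => hinj x y (f x) (hf x hx).2 (hxy ▸ (hf y hy).2)) hT

theorem countIn_le_of_rel {A B : Set ℕ} {a b a' b' : ℕ} (r : ℕ → ℕ → Prop)
    (h : ∀ x ∈ A, a ≤ x → x < b → ∃ y ∈ B, a' ≤ y ∧ y < b' ∧ r x y)
    (hinj : ∀ x x' y, r x y → r x' y → x = x') : countIn A a b ≤ countIn B a' b' := by
  refine ncard_le_ncard_of_rel ((Set.finite_Ico _ _).inter_of_right _) r ?_ hinj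
  rintro x ⟨hx, h1, h2⟩
  obtain ⟨y, hy, h3, h4, h5⟩ := h x hx h1 h2
  exact ⟨y, ⟨hy, h3, h4⟩, h5⟩

theorem countIn_le_of_injOn {A B : Set ℕ} {a b a' b' : ℕ} (f : ℕ → ℕ)
    (hf : ∀ x ∈ A, a ≤ x → x < b → f x ∈ B ∧ a' ≤ f x ∧ f x < b')
    (hinj : Set.InjOn f A) : countIn A a b ≤ countIn B a' b' := by
  refine Set.ncard_le_ncard_of_injOn f ?_ (hinj.mono Set.inter_subset_left)
    ((Set.finite_Ico _ _).inter_of_right _)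
  rintro x ⟨hx, h1, h2⟩
  exact hf x hx h1 h2

theorem countIn_mono {A B : Set ℕ} {a b a' b' : ℕ}
    (h : ∀ x ∈ A, a ≤ x → x < b → x ∈ B ∧ a' ≤ x ∧ x < b') : countIn A a b ≤ countIn B a' b' :=
  countIn_le_of_injOn id h (Set.injOn_id _)

theorem countIn_congr {A B : Set ℕ} {a b : ℕ} (h : ∀ x, a ≤ x → x < b → (x ∈ A ↔ x ∈ B)) :
    countIn A a b = countIn B a b :=
  le_antisymm (countIn_mono fun x hx h1 h2 => ⟨(h x h1 h2).1 hx, h1, h2⟩)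
    (countIn_mono fun x hx h1 h2 => ⟨(h x h1 h2).2 hx, h1, h2⟩)

theorem countIn_succ_le (A : Set ℕ) (a : ℕ) : countIn A a (a + 1) ≤ 1 := by
  unfold countIn
  refine (Set.ncard_le_ncard (Set.inter_subset_right) (Set.finite_Ico _ _)).trans ?_
  simp

theorem countIn_succ_of_mem {A : Set ℕ} {a : ℕ} (h : a ∈ A) : countIn A a (a + 1) = 1 := by
  have : A ∩ Set.Ico a (a + 1) = {a} := by
    ext x
    simp only [Set.mem_inter_iff, Set.mem_Ico, Set.mem_singleton_iff]
    constructor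
    · rintro ⟨_, _, _⟩; omega
    · rintro rfl; exact ⟨h, by omega, by omega⟩
  rw [countIn, this, Set.ncard_singleton]

theorem countIn_succ_of_notMem {A : Set ℕ} {a : ℕ} (h : a ∉ A) : countIn A a (a + 1) = 0 := by
  have : A ∩ Set.Ico a (a + 1) = ∅ := by
    ext x
    simp only [Set.mem_inter_iff, Set.mem_Ico, Set.mem_empty_iff_false, iff_false]
    rintro ⟨hx, _, _⟩
    obtain rfl : x = a := by omega
    exact h hx
  rw [countIn, this, Set.ncard_empty]

theorem tailCount_eq {A : Set ℕ} (hA : A.Finite) {a b : ℕ} (hab : a ≤ b) :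
    tailCount A a = countIn A a b + tailCount A b := by
  unfold countIn tailCount
  rw [← Set.ncard_union_eq _ ((Set.finite_Ico _ _).inter_of_right _)
    (hA.inter_of_left _), ← Set.inter_union_distrib_left,
    Set.Ico_union_Ici_eq_Ici hab]
  rw [Set.disjoint_left]
  rintro x ⟨_, hx⟩ ⟨_, hy⟩
  exact absurd hx.2 (not_lt.2 hy)

theorem tailCount_eq_zero {A : Set ℕ} {t : ℕ} (h : ∀ x ∈ A, x < t) : tailCount A t = 0 := by
  have : A ∩ Set.Ici t = ∅ := by
    ext x
    simp only [Set.mem_inter_iff, Set.mem_Ici, Set.mem_empty_iff_false, iff_false]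
    rintro ⟨hx, hy⟩
    exact absurd (h x hx) (not_lt.2 hy)
  rw [tailCount, this, Set.ncard_empty]

theorem tailCount_le_of_injOn {A B : Set ℕ} (hB : B.Finite) {a a' : ℕ} (f : ℕ → ℕ)
    (hf : ∀ x ∈ A, a ≤ x → f x ∈ B ∧ a' ≤ f x) (hinj : Set.InjOn f A) :
    tailCount A a ≤ tailCount B a' := by
  refine Set.ncard_le_ncard_of_injOn f ?_ (hinj.mono Set.inter_subset_left) (hB.inter_of_left _)
  rintro x ⟨hx, h1⟩
  exact hf x hx h1

theorem tailCount_mono {A B : Set ℕ} (hB : B.Finite) {a : ℕ} (h : ∀ x ∈ A, a ≤ x → x ∈ B) :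
    tailCount A a ≤ tailCount B a :=
  tailCount_le_of_injOn hB id (fun x hx h1 => ⟨h x hx h1, h1⟩) (Set.injOn_id _)

theorem tailCount_congr {A B : Set ℕ} {a : ℕ} (h : ∀ x, a ≤ x → (x ∈ A ↔ x ∈ B)) :
    tailCount A a = tailCount B a := by
  unfold tailCount
  congr 1
  ext x
  simp only [Set.mem_inter_iff, Set.mem_Ici]
  exact ⟨fun hx => ⟨(h x hx.2).1 hx.1, hx.2⟩, fun hx => ⟨(h x hx.2).2 hx.1, hx.2⟩⟩

theorem tailCount_antitone {A : Set ℕ} (hA : A.Finite) : Antitone (tailCount A) := fun a b h => by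
  rw [tailCount_eq hA h]; exact Nat.le_add_left _ _

theorem stepSet_tailCount {A : Set ℕ} (hA : A.Finite) : stepSet (tailCount A) = A := by
  ext t
  simp only [stepSet, Set.mem_ofPred_eq, tailCount_eq hA (Nat.le_succ t), Nat.succ_eq_add_one]
  by_cases h : t ∈ A
  · simp [h, countIn_succ_of_mem h]
  · simp [h, countIn_succ_of_notMem h]

/-! ### Elementary properties of a single slide -/

theorem slide_le (A : Set ℕ) (g : ℕ → ℕ) {t u : ℕ} (h : t ≤ u) :
    slide A g t ≤ countIn A t u + g (u + 1) :=
  ciInf_le (OrderBot.bddBelow _) (⟨u, h⟩ : Set.Ici t)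

theorem exists_slide_eq (A : Set ℕ) (g : ℕ → ℕ) (t : ℕ) :
    ∃ u, t ≤ u ∧ slide A g t = countIn A t u + g (u + 1) := by
  have : Nonempty (Set.Ici t) := ⟨⟨t, Set.self_mem_Ici⟩⟩
  obtain ⟨⟨u, hu⟩, h⟩ := Nat.sInf_mem
    (Set.range_nonempty fun u : Set.Ici t => countIn A t u + g (u + 1))
  exact ⟨u, hu, h.symm⟩

theorem le_slide {A : Set ℕ} {g : ℕ → ℕ} {t n : ℕ}
    (h : ∀ u, t ≤ u → n ≤ countIn A t u + g (u + 1)) : n ≤ slide A g t := by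
  obtain ⟨u, hu, he⟩ := exists_slide_eq A g t
  rw [he]
  exact h u hu

theorem slide_le_slide (A : Set ℕ) {g h : ℕ → ℕ} (hgh : ∀ t, g t ≤ h t) (t : ℕ) :
    slide A g t ≤ slide A h t :=
  le_slide fun _ hu => (slide_le A g hu).trans (Nat.add_le_add_left (hgh _) _)

/-- Together with `slide_add_const`, this makes sliding linear over `(min, +)`. It is what carries
the formula for the column of the removed cell over to the key. -/
theorem slide_min (A : Set ℕ) (g h : ℕ → ℕ) :
    slide A (fun t => min (g t) (h t)) = fun t => min (slide A g t) (slide A h t) := by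
  funext t
  refine le_antisymm (le_min (slide_le_slide A (fun _ => min_le_left _ _) t)
    (slide_le_slide A (fun _ => min_le_right _ _) t)) (le_slide fun u hu => ?_)
  have h1 := slide_le A g hu
  have h2 := slide_le A h hu
  omega

theorem slide_add_const (A : Set ℕ) (g : ℕ → ℕ) (n : ℕ) :
    slide A (fun t => g t + n) = fun t => slide A g t + n := by
  funext t
  refine le_antisymm ?_ (le_slide fun u hu => ?_)
  · obtain ⟨u, hu, he⟩ := exists_slide_eq A g t
    rw [he, add_assoc]
    exact slide_le A (fun t => g t + n) hu
  · have := slide_le A g hu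
    omega

theorem slide_zero (A : Set ℕ) : slide A (fun _ => 0) = fun _ => 0 := by
  funext t
  have := slide_le A (fun _ => 0) (le_refl t)
  rw [countIn_self] at this
  omega

theorem slide_antitone (A : Set ℕ) {g : ℕ → ℕ} (hg : Antitone g) : Antitone (slide A g) := by
  refine antitone_nat_of_succ_le fun t => le_slide fun u hu => ?_
  rcases hu.eq_or_lt with rfl | hlt
  · refine (slide_le A g le_rfl).trans ?_
    rw [countIn_self, countIn_self]
    simpa using hg (Nat.le_succ (t + 1))
  · refine (slide_le A g hlt).trans ?_
    rw [← countIn_add A (Nat.le_succ t) hlt, Nat.succ_eq_add_one]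
    omega

/-- `g` grows, from right to left, at most as fast as the counting function of `A`. -/
def CountBound (A : Set ℕ) (g : ℕ → ℕ) : Prop := ∀ t u, t ≤ u → g t ≤ countIn A t u + g u

theorem countBound_slide (A : Set ℕ) (g : ℕ → ℕ) : CountBound A (slide A g) := fun t u htu => by
  obtain ⟨v, hv, he⟩ := exists_slide_eq A g u
  have := slide_le A g (htu.trans hv)
  rw [← countIn_add A htu hv] at this
  omega

theorem countBound_tailCount {A : Set ℕ} (hA : A.Finite) : CountBound A (tailCount A) :=
  fun _ _ htu => (tailCount_eq hA htu).le

theorem CountBound.succ_le {A : Set ℕ} {g : ℕ → ℕ} (h : CountBound A g) (t : ℕ) :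
    g t ≤ g (t + 1) + 1 := by
  have := h t (t + 1) (Nat.le_succ t)
  have := countIn_succ_le A t
  omega

/-! ### Changes of a set that slides do not see -/

/-- Raising `g` at positions up to `x` does not change `slide A g` where `A` offers a cheaper way
past `x`. -/
theorem slide_eq_of_raise {A : Set ℕ} {h h' : ℕ → ℕ} {x : ℕ} (hle : ∀ t, h t ≤ h' t)
    (hx : h' (x + 1) ≤ h (x + 1))
    (H : ∀ u, h' (u + 1) ≤ h (u + 1) ∨ (u < x ∧ countIn A u x + h (x + 1) ≤ h (u + 1))) :
    slide A h' = slide A h := by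
  funext t
  refine le_antisymm (le_slide fun u hu => ?_) (slide_le_slide A hle t)
  rcases H u with h1 | ⟨h1, h2⟩
  · exact (slide_le A h' hu).trans (Nat.add_le_add_left h1 _)
  · have := slide_le A h' (hu.trans h1.le)
    rw [← countIn_add A hu h1.le] at this
    omega

theorem slide_insert_le (B : Set ℕ) (g : ℕ → ℕ) (m t : ℕ) :
    slide B g t ≤ slide (insert m B) g t :=
  le_slide fun _ hu => (slide_le B g hu).trans (Nat.add_le_add_right
    (countIn_mono fun _ hx h1 h2 => ⟨Set.mem_insert_of_mem _ hx, h1, h2⟩) _)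

theorem countIn_insert_of_lt {B : Set ℕ} {m a b : ℕ} (h : m < a) :
    countIn (insert m B) a b = countIn B a b :=
  countIn_congr fun x h1 _ => by
    rw [Set.mem_insert_iff]
    exact or_iff_right (by omega)

theorem countIn_insert_of_le {B : Set ℕ} {m a b : ℕ} (h : b ≤ m) :
    countIn (insert m B) a b = countIn B a b :=
  countIn_congr fun x _ h1 => by
    rw [Set.mem_insert_iff]
    exact or_iff_right (by omega)

/-- Adding `m` to the column `B` is invisible after a slide through a column `A` whose elements
below `m` are dominated by those of `B`. -/
theorem slide_slide_insert {A B : Set ℕ} (g : ℕ → ℕ) {m : ℕ}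
    (hAB : ∀ u, u < m → countIn A u m ≤ countIn B (u + 1) m) :
    slide A (slide (insert m B) g) = slide A (slide B g) := by
  have hgt : ∀ t, m < t → slide (insert m B) g t ≤ slide B g t := fun t ht =>
    le_slide fun u hu => by
      have := slide_le (insert m B) g hu
      rwa [countIn_insert_of_lt ht] at this
  refine slide_eq_of_raise (x := m) (slide_insert_le B g m) (hgt _ (Nat.lt_succ_self m))
    fun u => ?_
  by_cases hu : u < m
  -- An optimal inner cut `v ≤ m` does not see the new element. If `v > m`, splitting `[u + 1, v)`
  -- at `m` and using `hAB` shows that the outer cut `m` is at most as expensive as `u`.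
  · obtain ⟨v, hv, he⟩ := exists_slide_eq B g (u + 1)
    by_cases hvm : v ≤ m
    · left
      have := slide_le (insert m B) g hv
      rwa [countIn_insert_of_le hvm, ← he] at this
    · right
      refine ⟨hu, ?_⟩
      have h1 := hAB u hu
      have h2 := slide_le B g (t := m + 1) (u := v) (by omega)
      have h3 := countIn_add B (a := u + 1) (b := m) (c := v) (by omega) (by omega)
      have h4 := countIn_add B (a := m) (b := m + 1) (c := v) (by omega) (by omega)
      omega
  · exact Or.inl (hgt _ (by omega))

/-- The analogue of `slide_slide_insert` when `B` is the last column: by domination, every cut `u <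
m` can be moved to `m` at no cost. -/
theorem slide_tailCount_insert {A B : Set ℕ} (hB : B.Finite) {m : ℕ}
    (hAB : ∀ u, u < m → countIn A u m ≤ countIn B (u + 1) m) :
    slide A (tailCount (insert m B)) = slide A (tailCount B) := by
  have hgt : ∀ t, m < t → tailCount (insert m B) t ≤ tailCount B t := fun t ht =>
    (tailCount_congr fun x hx => by
      rw [Set.mem_insert_iff]; exact or_iff_right (by omega)).le
  refine slide_eq_of_raise (x := m)
    (fun t => tailCount_mono (hB.insert m) fun x hx _ => Set.mem_insert_of_mem _ hx)
    (hgt _ (Nat.lt_succ_self m)) fun u => ?_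
  by_cases hu : u < m
  · right
    refine ⟨hu, ?_⟩
    have h1 := hAB u hu
    have h2 := tailCount_eq hB (a := u + 1) (b := m) (by omega)
    have h3 := tailCount_eq hB (a := m) (b := m + 1) (by omega)
    omega
  · exact Or.inl (hgt _ (by omega))

/-- Removing `m` from the column `A` is invisible for slides of subsets of a column `B` whose
elements above `m` dominate elements of `A` above `m`. -/
theorem slide_diff_singleton {A B : Set ℕ} {g : ℕ → ℕ} (hg : CountBound B g) {m : ℕ}
    (hAB : ∀ u, m < u → countIn B (m + 1) (u + 1) ≤ countIn A (m + 1) u) :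
    slide (A \ {m}) g = slide A g := by
  have hle : ∀ a b, countIn (A \ {m}) a b ≤ countIn A a b := fun a b =>
    countIn_mono fun x hx h1 h2 => ⟨hx.1, h1, h2⟩
  have heq : ∀ a b, m < a ∨ b ≤ m → countIn (A \ {m}) a b = countIn A a b := fun a b h =>
    countIn_congr fun x h1 h2 => by
      simp only [Set.mem_sdiff, Set.mem_singleton_iff, and_iff_left_iff_imp]
      intro _; omega
  funext t
  refine le_antisymm (le_slide fun u hu => (slide_le _ g hu).trans
    (Nat.add_le_add_right (hle _ _) _)) (le_slide fun u hu => ?_)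
  by_cases h : m < t ∨ u ≤ m
  · rw [heq _ _ h]
    exact slide_le A g hu
  · push Not at h
    -- Here `t ≤ m < u`, the only cuts that notice the removal. The cut at `m` is no more expensive:
    -- between `m + 1` and `u + 1` the function `g` grows at most like `B`, hence at most like `A`
    -- on `[m + 1, u)`.
    have h1 := slide_le A g h.1
    have h2 := hAB u h.2
    have h3 := hg (m + 1) (u + 1) (by omega)
    have h4 := countIn_add (A \ {m}) (a := t) (b := m) (c := u) h.1 (by omega)
    have h5 := countIn_add (A \ {m}) (a := m) (b := m + 1) (c := u) (by omega) (by omega)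
    rw [heq _ _ (Or.inr le_rfl)] at h4
    rw [heq (m + 1) _ (Or.inl (by omega))] at h5
    omega

theorem countIn_swap {B : Set ℕ} {m x a b : ℕ} (h : x < a ∨ b ≤ m ∨ (m < a ∧ b ≤ x)) (hmx : m < x) :
    countIn (insert x (B \ {m})) a b = countIn B a b :=
  countIn_congr fun y h1 h2 => by
    simp only [Set.mem_insert_iff, Set.mem_sdiff, Set.mem_singleton_iff]
    constructor
    · rintro (rfl | hy)
      · omega
      · exact hy.1
    · intro hy
      exact Or.inr ⟨hy, by omega⟩

/-- Replacing `m` by a larger `x` in the last column. -/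
theorem slide_tailCount_swap {A B : Set ℕ} (hB : B.Finite) {m x : ℕ} (hmx : m < x) (hm : m ∈ B)
    (hx : x ∉ B) (hAB : ∀ u, m ≤ u → u < x → countIn A u x ≤ countIn B (u + 1) x) :
    slide A (tailCount (insert x (B \ {m}))) = slide A (tailCount B) := by
  set B' := insert x (B \ {m}) with hB'
  have hfin : B'.Finite := (hB.sdiff).insert x
  have e1 : ∀ t, x < t → tailCount B' t = tailCount B t := fun t ht =>
    tailCount_congr fun y hy => by
      simp only [hB', Set.mem_insert_iff, Set.mem_sdiff, Set.mem_singleton_iff]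
      constructor
      · rintro (rfl | h)
        · omega
        · exact h.1
      · exact fun h => Or.inr ⟨h, by omega⟩
  have e2 : tailCount B' x = tailCount B x + 1 := by
    rw [tailCount_eq hfin (Nat.le_add_right x 1), tailCount_eq hB (Nat.le_add_right x 1),
      e1 (x + 1) (by omega), countIn_succ_of_mem (Set.mem_insert _ _),
      countIn_succ_of_notMem hx]
    omega
  have e3 : ∀ t, m < t → t ≤ x → tailCount B' t = tailCount B t + 1 := fun t h1 h2 => by
    rw [tailCount_eq hfin h2, tailCount_eq hB h2, e2, countIn_swap (by omega) hmx]
    omega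
  have e4 : tailCount B' m = tailCount B m := by
    have hm' : m ∉ B' := by
      rintro (h | h)
      · omega
      · exact h.2 rfl
    rw [tailCount_eq hfin (Nat.le_add_right m 1), tailCount_eq hB (Nat.le_add_right m 1),
      e3 _ (by omega) (by omega), countIn_succ_of_mem hm, countIn_succ_of_notMem hm']
    omega
  have e5 : ∀ t, t ≤ m → tailCount B' t = tailCount B t := fun t h => by
    rw [tailCount_eq hfin h, tailCount_eq hB h, e4, countIn_swap (by omega) hmx]
  -- The counting function has been raised, by one, exactly on `(m, x]`. The affected cuts `m ≤ u <
  -- x` can be moved to `x`.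
  refine slide_eq_of_raise (x := x) (fun t => ?_) (e1 _ (by omega)).le fun u => ?_
  · rcases le_or_gt t m with h | h
    · exact (e5 t h).ge
    · rcases le_or_gt t x with h' | h'
      · rw [e3 t h h']; omega
      · exact (e1 t h').ge
  · by_cases hu : m ≤ u ∧ u < x
    · right
      refine ⟨hu.2, ?_⟩
      have h1 := hAB u hu.1 hu.2
      have h2 := tailCount_eq hB (a := u + 1) (b := x) (by omega)
      have h3 := tailCount_eq hB (a := x) (b := x + 1) (by omega)
      omega
    · left
      rcases le_or_gt (u + 1) m with h | h
      · exact (e5 _ h).le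
      · exact (e1 _ (by omega)).le

/-- Removing a smaller element leaves a larger counting function. -/
theorem tailCount_diff_le {W : Set ℕ} (hW : W.Finite) {m m' : ℕ} (hm : m ∈ W) (hlt : m' < m)
    (t : ℕ) : tailCount (W \ {m}) t ≤ tailCount (W \ {m'}) t := by
  classical
  refine tailCount_le_of_injOn hW.sdiff (fun x => if x = m' then m else x) ?_ ?_
  · rintro x ⟨hx, hxm⟩ htx
    split_ifs with h
    · exact ⟨⟨hm, fun h' => by rw [Set.mem_singleton_iff] at h'; omega⟩, by omega⟩
    · exact ⟨⟨hx, h⟩, htx⟩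
  · rintro x ⟨hx, hxm⟩ y ⟨hy, hym⟩ hxy
    rw [Set.mem_singleton_iff] at hxm hym
    dsimp only at hxy
    split_ifs at hxy <;> omega

/-- If the elements of `A` are matched with larger elements of `B`, then the slide of `B` through
`A` is `A`. -/
theorem slide_tailCount_of_le {A B : Set ℕ} (hA : A.Finite)
    (h : ∀ u, tailCount A u ≤ tailCount B (u + 1)) (hB : B.Finite) :
    slide A (tailCount B) = tailCount A := by
  funext t
  refine le_antisymm ?_ (le_slide fun u hu => ?_)
  · obtain ⟨n, hn⟩ := (hA.union hB).bddAbove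
    have h1 := slide_le A (tailCount B) (t := t) (u := max t (n + 1)) (le_max_left _ _)
    rw [tailCount_eq_zero (A := B) (fun x hx => ?_)] at h1
    · rw [tailCount_eq hA (le_max_left t (n + 1))]
      omega
    · have := hn (Or.inr hx); omega
  · rw [tailCount_eq hA hu]
    exact Nat.add_le_add_left (h u) _

/-- Sliding preserves inclusion. -/
theorem slide_sub_antitone (A : Set ℕ) {g h : ℕ → ℕ} (hg : Antitone g) (hh : Antitone h)
    (H : ∀ t u, t ≤ u → g u + h t ≤ g t + h u) (t u : ℕ) (htu : t ≤ u) :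
    slide A g u + slide A h t ≤ slide A g t + slide A h u := by
  induction u, htu using Nat.le_induction with
  | base => omega
  | succ u htu ih =>
    refine Nat.le_of_add_le_add_right (b := slide A g u + slide A h u) ?_
    suffices slide A g (u + 1) + slide A h u ≤ slide A g u + slide A h (u + 1) by omega
    have a1 := slide_antitone A hg (Nat.le_succ u)
    have a2 := slide_antitone A hh (Nat.le_succ u)
    have b1 := (countBound_slide A g) u (u + 1) (Nat.le_succ u)
    have b2 := (countBound_slide A h) u (u + 1) (Nat.le_succ u)
    have c := countIn_succ_le A u
    simp only [Nat.succ_eq_add_one] at *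
    by_contra hcon
    push Not at hcon
    -- the slide of `g` does not grow at `u`, the slide of `h` does
    obtain ⟨v, hv, he⟩ := exists_slide_eq A g u
    have hc : countIn A u (u + 1) = 1 := by omega
    -- If the optimal cut of `g` at `u` is `u` itself, using the optimal cut `w` of `h` for `g` and
    -- the cut `u` for `h` contradicts `H`. Otherwise the cut of `g` counts `u ∈ A`, so the slide of
    -- `g` does grow.
    rcases hv.eq_or_lt with rfl | hlt
    · rw [countIn_self] at he
      obtain ⟨w, hw, hew⟩ := exists_slide_eq A h (u + 1)
      have h1 := slide_le A g hw
      have h2 := slide_le A h (le_refl u)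
      rw [countIn_self] at h2
      have h3 := H (u + 1) (w + 1) (by omega)
      omega
    · have h1 := slide_le A g (t := u + 1) (u := v) hlt
      have h2 := countIn_add A (a := u) (b := u + 1) (c := v) (by omega) hlt
      omega

/-! ### Iterated slides -/

theorem slideAll_congr {A B : ℕ → Set ℕ} {c k : ℕ} (h : ∀ d, c ≤ d → d < c + k → A d = B d)
    (g : ℕ → ℕ) : slideAll A c k g = slideAll B c k g := by
  induction k generalizing c with
  | zero => rfl
  | succ k ih =>
    rw [slideAll, slideAll, h c le_rfl (by omega), ih fun d h1 h2 => h d (by omega) (by omega)]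

theorem slideAll_add (A : ℕ → Set ℕ) (c k l : ℕ) (g : ℕ → ℕ) :
    slideAll A c (k + l) g = slideAll A c k (slideAll A (c + k) l g) := by
  induction k generalizing c with
  | zero => simp [slideAll]
  | succ k ih =>
    rw [show k + 1 + l = (k + l) + 1 by omega, slideAll, slideAll, ih,
      show c + 1 + k = c + (k + 1) by omega]

theorem slideAll_mono (A : ℕ → Set ℕ) (c k : ℕ) {g h : ℕ → ℕ} (hgh : ∀ t, g t ≤ h t) (t : ℕ) :
    slideAll A c k g t ≤ slideAll A c k h t := by
  induction k generalizing c t with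
  | zero => exact hgh t
  | succ k ih => exact slide_le_slide _ (ih _) t

theorem slideAll_min (A : ℕ → Set ℕ) (c k : ℕ) (g h : ℕ → ℕ) :
    slideAll A c k (fun t => min (g t) (h t)) =
      fun t => min (slideAll A c k g t) (slideAll A c k h t) := by
  induction k generalizing c with
  | zero => rfl
  | succ k ih => rw [slideAll, ih, slide_min]; rfl

theorem slideAll_add_const (A : ℕ → Set ℕ) (c k : ℕ) (g : ℕ → ℕ) (n : ℕ) :
    slideAll A c k (fun t => g t + n) = fun t => slideAll A c k g t + n := by
  induction k generalizing c with
  | zero => rfl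
  | succ k ih => rw [slideAll, ih, slide_add_const]; rfl

theorem slideAll_zero (A : ℕ → Set ℕ) (c k : ℕ) :
    slideAll A c k (fun _ => 0) = fun _ => 0 := by
  induction k generalizing c with
  | zero => rfl
  | succ k ih => rw [slideAll, ih, slide_zero]

theorem slideAll_antitone (A : ℕ → Set ℕ) (c k : ℕ) {g : ℕ → ℕ} (hg : Antitone g) :
    Antitone (slideAll A c k g) := by
  induction k generalizing c with
  | zero => exact hg
  | succ k ih => exact slide_antitone _ (ih _)

theorem slideAll_sub_antitone (A : ℕ → Set ℕ) (c k : ℕ) {g h : ℕ → ℕ} (hg : Antitone g)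
    (hh : Antitone h) (H : ∀ t u, t ≤ u → g u + h t ≤ g t + h u) (t u : ℕ) (htu : t ≤ u) :
    slideAll A c k g u + slideAll A c k h t ≤ slideAll A c k g t + slideAll A c k h u := by
  induction k generalizing c t u with
  | zero => exact H t u htu
  | succ k ih =>
    exact slide_sub_antitone _ (slideAll_antitone _ _ _ hg) (slideAll_antitone _ _ _ hh)
      (ih _) t u htu

theorem countBound_slideAll {A : ℕ → Set ℕ} (c k : ℕ) {g : ℕ → ℕ} (hg : CountBound (A (c + k)) g) :
    CountBound (A c) (slideAll A c k g) := by
  cases k with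
  | zero => exact hg
  | succ k => exact countBound_slide _ _

/-- If each column dominates a part of the previous one, sliding preserves the size. -/
theorem slideAll_apply_zero {A : ℕ → Set ℕ} (c k : ℕ) {g : ℕ → ℕ} (hg : CountBound (A (c + k)) g)
    (hanti : Antitone g)
    (hA : ∀ d, c ≤ d → d < c + k → ∀ u, countIn (A (d + 1)) 0 (u + 1) ≤ countIn (A d) 0 u) :
    slideAll A c k g 0 = g 0 := by
  induction k generalizing c with
  | zero => rfl
  | succ k ih =>
    have hb : CountBound (A (c + 1 + k)) g := by rwa [show c + 1 + k = c + (k + 1) by omega]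
    have h0 := ih (c + 1) hb fun d h1 h2 => hA d (by omega) (by omega)
    rw [slideAll]
    refine le_antisymm ?_ (le_slide fun u _ => ?_)
    · refine (slide_le _ _ le_rfl).trans ?_
      rw [countIn_self, ← h0]
      simpa using slideAll_antitone A (c + 1) k hanti (Nat.zero_le 1)
    · have h1 := countBound_slideAll (c + 1) k hb 0 (u + 1) (Nat.zero_le _)
      have h2 := hA c le_rfl (by omega) u
      omega

theorem keyCount_congr {A B : ℕ → Set ℕ} {j : ℕ} (h : ∀ d, d ≤ j → A d = B d) :
    keyCount A j = keyCount B j := by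
  rw [keyCount, keyCount, h j le_rfl, slideAll_congr fun d _ h2 => h d (by omega)]

/-- `keyCount` split at the columns `c`, `c + 1`. -/
theorem keyCount_split (A : ℕ → Set ℕ) (c k : ℕ) :
    keyCount A (c + k) = slideAll A 0 c (slideAll A c k (tailCount (A (c + k)))) := by
  rw [keyCount, slideAll_add, Nat.zero_add]

/-! ### The left key through slides -/

/-- Adding `m` to some columns and removing it from others, under the conditions that hold in a
K-jeu-de-taquin move, does not change `keyCount`. -/
theorem keyCount_eq_of_move {A A' : ℕ → Set ℕ} {m j : ℕ} (hfin : ∀ c, (A c).Finite)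
    (hne : ∀ c x, x ≠ m → (x ∈ A' c ↔ x ∈ A c))
    (hadd : ∀ c, m ∈ A' c → m ∉ A c → ∃ d, c = d + 1 ∧ m ∈ A d ∧
      ∀ u, u < m → countIn (A d) u m ≤ countIn (A c) (u + 1) m)
    (hrem : ∀ c, m ∈ A c → m ∉ A' c → ∀ u, m < u →
      countIn (A (c + 1)) (m + 1) (u + 1) ≤ countIn (A c) (m + 1) u)
    (hlast : m ∈ A j → m ∈ A' j) : keyCount A' j = keyCount A j := by
  -- The unions separate the two effects: from `A` to `B` the number `m` is only added, from `B` to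
  -- `A'` it is only removed.
  set B : ℕ → Set ℕ := fun c => A c ∪ A' c with hB
  have hB1 : ∀ c, ¬ (m ∈ A' c ∧ m ∉ A c) → B c = A c := fun c hc => by
    ext x
    simp only [hB, Set.mem_union]
    by_cases hx : x = m
    · subst hx; tauto
    · rw [hne c x hx]; tauto
  have hB2 : ∀ c, m ∈ A' c → B c = insert m (A c) := fun c hc => by
    ext x
    simp only [hB, Set.mem_union, Set.mem_insert_iff]
    by_cases hx : x = m
    · subst hx; tauto
    · rw [hne c x hx]; tauto
  have hB3 : ∀ c, (m ∈ A c → m ∈ A' c) → A' c = B c := fun c hc => by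
    ext x
    simp only [hB, Set.mem_union]
    by_cases hx : x = m
    · subst hx; tauto
    · rw [hne c x hx]; tauto
  have hB4 : ∀ c, m ∉ A' c → A' c = B c \ {m} := fun c hc => by
    ext x
    simp only [hB, Set.mem_union, Set.mem_sdiff, Set.mem_singleton_iff]
    by_cases hx : x = m
    · subst hx; tauto
    · rw [hne c x hx]; tauto
  have hB5 : ∀ c a b, m < a → countIn (B c) a b = countIn (A c) a b := fun c a b h =>
    countIn_congr fun x h1 _ => by
      simp only [hB, Set.mem_union, hne c x (by omega), or_self]
  have hBfin : ∀ c, (B c).Finite := fun c =>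
    ((hfin c).insert m).subset fun x hx => by
      by_cases h : x = m
      · exact Or.inl h
      · exact Or.inr (hx.elim id (hne c x h).1)
  -- An added `m` is forgotten after one more slide. This suffices since two adjacent columns never
  -- both gain `m` (a gain requires `m` in the left neighbour beforehand) and column `0` never gains
  -- it.
  have key1 : ∀ k c, c + k = j →
      ((m ∈ A' c → m ∈ A c) →
        slideAll B c k (tailCount (B j)) = slideAll A c k (tailCount (A j))) ∧
      (∀ d, c = d + 1 → slide (A d) (slideAll B c k (tailCount (B j))) =
        slide (A d) (slideAll A c k (tailCount (A j)))) := by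
    intro k
    induction k with
    | zero =>
      rintro c hc
      obtain rfl : c = j := hc
      have h1 : (m ∈ A' c → m ∈ A c) → slideAll B c 0 (tailCount (B c)) =
          slideAll A c 0 (tailCount (A c)) := fun h => by
        rw [hB1 c fun h' => h'.2 (h h'.1)]; rfl
      refine ⟨h1, ?_⟩
      rintro d hd
      by_cases h : m ∈ A' c → m ∈ A c
      · rw [h1 h]
      · push Not at h
        obtain ⟨d', hd', _, hcond⟩ := hadd c h.1 h.2
        obtain rfl : d' = d := by omega
        rw [hB2 c h.1]
        exact slide_tailCount_insert (hfin c) hcond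
    | succ k ih =>
      rintro c hc
      obtain ⟨ih1, ih2⟩ := ih (c + 1) (by omega)
      have h1 : (m ∈ A' c → m ∈ A c) → slideAll B c (k + 1) (tailCount (B j)) =
          slideAll A c (k + 1) (tailCount (A j)) := fun h => by
        rw [slideAll, slideAll, hB1 c fun h' => h'.2 (h h'.1), ih2 c rfl]
      refine ⟨h1, ?_⟩
      rintro d hd
      by_cases h : m ∈ A' c → m ∈ A c
      · rw [h1 h]
      · push Not at h
        obtain ⟨d', hd', _, hcond⟩ := hadd c h.1 h.2
        obtain rfl : d' = d := by omega
        rw [slideAll, slideAll, hB2 c h.1, ih1, slide_slide_insert _ hcond]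
        intro hm
        by_contra hm'
        obtain ⟨e, he, hme, _⟩ := hadd (c + 1) hm hm'
        obtain rfl : e = c := by omega
        exact h.2 hme
  -- A removal is invisible because the function arriving from the right grows at most like column
  -- `c + 1`, which above `m` is dominated by column `c`.
  have key2 : ∀ k c, c + k = j →
      slideAll A' c k (tailCount (A' j)) = slideAll B c k (tailCount (B j)) := by
    intro k
    induction k with
    | zero => intro c _; rw [hB3 j hlast]; rfl
    | succ k ih =>
      rintro c hc
      rw [slideAll, slideAll, ih (c + 1) (by omega)]
      by_cases hm : m ∈ A c → m ∈ A' c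
      · rw [hB3 c hm]
      · push Not at hm
        rw [hB4 c hm.2]
        refine slide_diff_singleton (B := B (c + 1))
          (countBound_slideAll _ _ ?_) fun u hu => ?_
        · rw [show c + 1 + k = j by omega]
          exact countBound_tailCount (hBfin j)
        · rw [hB5 _ _ _ (by omega), hB5 _ _ _ (by omega)]
          exact hrem c hm.1 hm.2 u hu
  rw [keyCount, keyCount, key2 j 0 (by omega)]
  refine (key1 j 0 (by omega)).1 fun h => ?_
  by_contra h'
  obtain ⟨d, hd, _⟩ := hadd 0 h h'
  omega

/-! ### Dotted tableaux and a single K-jeu-de-taquin move -/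

/-- The set of numbers in column `c` of a dotted skew tableau. -/
def colSet (T : DotFilling) (c : ℕ) : Set ℕ := {x | ∃ i, T i c = .num x}

/-- The position of an entry in the order in which `•` is between `n` and `n + 1`. -/
def dotVal (n : ℕ) : DotEntry → ℕ
  | .empty => 0
  | .dot => 2 * n + 2
  | .num x => 2 * x + 1

/-- A dotted increasing skew tableau with outer column lengths `h`, with entries in `[1, N]`,
in which `•` counts as a number between `n` and `n + 1`. -/
structure IsDotted (h : ℕ → ℕ) (N n : ℕ) (T : DotFilling) : Prop where
  anti : Antitone h
  out : ∀ i c, h c ≤ i → T i c = .empty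
  bound : ∀ i c x, T i c = .num x → 0 < x ∧ x ≤ N
  right : ∀ i c, i < h (c + 1) → T i c ≠ .empty → dotVal n (T i c) < dotVal n (T i (c + 1))
  down : ∀ i c, i + 1 < h c → T i c ≠ .empty → dotVal n (T i c) < dotVal n (T (i + 1) c)

theorem dotVal_pos {n : ℕ} {e : DotEntry} : 0 < dotVal n e ↔ e ≠ .empty := by
  cases e <;> simp [dotVal]

namespace IsDotted

variable {h : ℕ → ℕ} {N n : ℕ} {T : DotFilling}

theorem lt_of_ne (hT : IsDotted h N n T) {i c : ℕ} (hne : T i c ≠ .empty) : i < h c := by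
  by_contra hcon
  exact hne (hT.out i c (not_lt.1 hcon))

theorem col_lt (hT : IsDotted h N n T) {i i' c : ℕ} (hii : i < i') (hi : i' < h c)
    (hne : T i c ≠ .empty) : dotVal n (T i c) < dotVal n (T i' c) := by
  induction i', hii using Nat.le_induction with
  | base => exact hT.down i c hi hne
  | succ k hk ih =>
    have h1 := ih (by omega)
    exact h1.trans (hT.down k c hi (dotVal_pos.1 (Nat.zero_lt_of_lt h1)))

theorem row_unique (hT : IsDotted h N n T) {i i' c : ℕ} (hne : T i c ≠ .empty)
    (heq : T i c = T i' c) : i = i' := by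
  rcases lt_trichotomy i i' with hlt | rfl | hlt
  · have := hT.col_lt hlt (hT.lt_of_ne (heq ▸ hne)) hne
    rw [heq] at this
    exact absurd this (lt_irrefl _)
  · rfl
  · have := hT.col_lt hlt (hT.lt_of_ne hne) (heq ▸ hne)
    rw [heq] at this
    exact absurd this (lt_irrefl _)

theorem row_lt_of_val_lt (hT : IsDotted h N n T) {i i' c : ℕ} (hne' : T i c ≠ .empty)
    (hlt : dotVal n (T i c) < dotVal n (T i' c)) : i < i' := by
  have hne : T i' c ≠ .empty := dotVal_pos.1 (Nat.zero_lt_of_lt hlt)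
  by_contra hcon
  rcases (not_lt.1 hcon).eq_or_lt with rfl | h'
  · exact absurd hlt (lt_irrefl _)
  · exact absurd hlt (hT.col_lt h' (hT.lt_of_ne hne') hne).not_gt

theorem colSet_finite (hT : IsDotted h N n T) (c : ℕ) : (colSet T c).Finite :=
  (Set.finite_Iic N).subset fun _ ⟨i, hi⟩ => (hT.bound i c _ hi).2

end IsDotted

theorem revKjdt_ne {m : ℕ} {T : DotFilling} {i c : ℕ} (h1 : T i c ≠ .dot) (h2 : T i c ≠ .num m) :
    revKjdt m T i c = T i c := by
  simp [revKjdt, h1, h2]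

theorem revKjdt_dot_of_neighbor {m : ℕ} {T : DotFilling} {i c : ℕ} (h1 : T i c = .dot)
    (h2 : HasNeighbor T i c (.num m)) : revKjdt m T i c = .num m := by
  simp [revKjdt, h1, h2]

theorem revKjdt_num_of_neighbor {m : ℕ} {T : DotFilling} {i c : ℕ} (h1 : T i c = .num m)
    (h2 : HasNeighbor T i c .dot) : revKjdt m T i c = .dot := by
  simp [revKjdt, h1, h2]

/-- `•` and `m + 1` are consecutive both in the old order, where `•` is the larger, and in the new
one, where it is the smaller. All other values stay the same and lie outside this block. -/
theorem dotVal_revKjdt (m : ℕ) (T : DotFilling) (i c : ℕ) :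
    ((T i c = .dot ∨ T i c = .num (m + 1)) ∧ 2 * m + 2 ≤ dotVal m (revKjdt (m + 1) T i c) ∧
      dotVal m (revKjdt (m + 1) T i c) ≤ 2 * m + 3) ∨
    (T i c ≠ .dot ∧ T i c ≠ .num (m + 1) ∧
      dotVal m (revKjdt (m + 1) T i c) = dotVal (m + 1) (T i c) ∧
      (dotVal (m + 1) (T i c) ≤ 2 * m + 1 ∨ 2 * m + 5 ≤ dotVal (m + 1) (T i c))) := by
  rcases hT : T i c with _ | _ | x
  · right
    rw [revKjdt_ne (by simp [hT]) (by simp [hT]), hT]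
    simp [dotVal]
  · left
    refine ⟨Or.inl rfl, ?_⟩
    simp only [revKjdt, hT]
    split_ifs <;> simp_all [dotVal]; omega
  · by_cases hx : x = m + 1
    · left
      subst hx
      refine ⟨Or.inr rfl, ?_⟩
      simp only [revKjdt, hT]
      split_ifs <;> simp_all [dotVal]; omega
    · right
      rw [revKjdt_ne (by simp [hT]) (by simp [hT, hx]), hT]
      simp only [dotVal]
      exact ⟨by simp, by simpa using hx, trivial, by omega⟩

theorem revKjdt_eq_empty_iff {m : ℕ} {T : DotFilling} {i c : ℕ} :
    revKjdt m T i c = .empty ↔ T i c = .empty := by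
  unfold revKjdt
  split_ifs with h1 h2
  · simp [h1.1]
  · simp [h2.1]
  · rfl

/-- Only an `m + 1` followed by a `•` could violate the new order, and being adjacent the two are
exchanged. -/
theorem dotVal_lt_revKjdt {m i c i' c' : ℕ} {T : DotFilling}
    (hlt : dotVal (m + 1) (T i c) < dotVal (m + 1) (T i' c'))
    (hn : HasNeighbor T i c (T i' c')) (hn' : HasNeighbor T i' c' (T i c)) :
    dotVal m (revKjdt (m + 1) T i c) < dotVal m (revKjdt (m + 1) T i' c') := by
  rcases dotVal_revKjdt m T i c with ⟨h1, h2, h3⟩ | ⟨h1, h2, h3, h4⟩ <;>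
    rcases dotVal_revKjdt m T i' c' with ⟨k1, k2, k3⟩ | ⟨k1, k2, k3, k4⟩
  · rcases h1 with h1 | h1 <;> rcases k1 with k1 | k1 <;> rw [h1, k1] at hlt <;>
      simp only [dotVal] at hlt
    · omega
    · omega
    · rw [revKjdt_num_of_neighbor h1 (k1 ▸ hn), revKjdt_dot_of_neighbor k1 (h1 ▸ hn')]
      simp only [dotVal]; omega
    · omega
  · have : 2 * (m + 1) + 1 ≤ dotVal (m + 1) (T i c) := by
      rcases h1 with h1 | h1 <;> rw [h1] <;> simp [dotVal]
    omega
  · have : dotVal (m + 1) (T i' c') ≤ 2 * (m + 1) + 2 := by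
      rcases k1 with h1 | h1 <;> rw [h1] <;> simp [dotVal]
    omega
  · omega

theorem IsDotted.revKjdt {h : ℕ → ℕ} {N m : ℕ} {T : DotFilling} (hT : IsDotted h N (m + 1) T)
    (hm : m + 1 ≤ N) : IsDotted h N m (revKjdt (m + 1) T) where
  anti := hT.anti
  out i c hi := revKjdt_eq_empty_iff.2 (hT.out i c hi)
  bound i c x hx := by
    unfold Tableau.revKjdt at hx
    split_ifs at hx
    · cases hx; omega
    · exact hT.bound i c x hx
  right i c hi hne := by
    refine dotVal_lt_revKjdt (hT.right i c hi fun h' => hne (revKjdt_eq_empty_iff.2 h')) ?_ ?_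
    · exact Or.inr (Or.inl rfl)
    · exact Or.inr (Or.inr (Or.inr ⟨by omega, by simp⟩))
  down i c hi hne := by
    refine dotVal_lt_revKjdt (hT.down i c hi fun h' => hne (revKjdt_eq_empty_iff.2 h')) ?_ ?_
    · exact Or.inl rfl
    · exact Or.inr (Or.inr (Or.inl ⟨by omega, by simp⟩))

theorem mem_colSet_revKjdt_of_ne {m x c : ℕ} {T : DotFilling} (hx : x ≠ m) :
    x ∈ colSet (revKjdt m T) c ↔ x ∈ colSet T c := by
  constructor
  · rintro ⟨i, hi⟩
    unfold revKjdt at hi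
    split_ifs at hi
    · cases hi; exact absurd rfl hx
    · exact ⟨i, hi⟩
  · rintro ⟨i, hi⟩
    refine ⟨i, ?_⟩
    rw [revKjdt_ne (by simp [hi]) (by simpa [hi] using hx), hi]

namespace IsDotted

variable {h : ℕ → ℕ} {N m : ℕ} {T : DotFilling}

theorem dot_ne_right (hT : IsDotted h N m T) {i c : ℕ} (hd : T i c = .dot) :
    T i (c + 1) ≠ .num m := fun hm => by
  have := hT.right i c (hT.lt_of_ne (by simp [hm])) (by simp [hd])
  rw [hd, hm] at this
  simp only [dotVal] at this
  omega

theorem dot_ne_below (hT : IsDotted h N m T) {i c : ℕ} (hd : T i c = .dot) :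
    T (i + 1) c ≠ .num m := fun hm => by
  have := hT.down i c (hT.lt_of_ne (by simp [hm])) (by simp [hd])
  rw [hd, hm] at this
  simp only [dotVal] at this
  omega

theorem exists_of_gain (hT : IsDotted h N m T) {c : ℕ} (h1 : m ∈ colSet (Tableau.revKjdt m T) c)
    (h2 : m ∉ colSet T c) : ∃ i d, c = d + 1 ∧ T i d = .num m ∧ T i c = .dot := by
  obtain ⟨i, hi⟩ := h1
  unfold Tableau.revKjdt at hi
  split_ifs at hi with h3 h4
  · obtain ⟨hd, hn⟩ := h3
    rcases hn with hn | hn | ⟨_, hn⟩ | ⟨hc, hn⟩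
    · exact absurd ⟨_, hn⟩ h2
    · exact absurd hn (hT.dot_ne_right hd)
    · exact absurd ⟨_, hn⟩ h2
    · exact ⟨i, c - 1, by omega, hn, hd⟩
  · exact absurd ⟨i, hi⟩ h2

/-- In the current order `•` exceeds `m`, so a `•` next to `m` is to its right or below it. One
below would turn into `m` and keep `m` in the column. -/
theorem exists_of_loss (hT : IsDotted h N m T) {c : ℕ} (h1 : m ∈ colSet T c)
    (h2 : m ∉ colSet (Tableau.revKjdt m T) c) :
    ∃ i, T i c = .num m ∧ T i (c + 1) = .dot ∧ ∀ k, T k c ≠ .dot := by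
  obtain ⟨i, hi⟩ := h1
  have hbelow : T (i + 1) c ≠ .dot := fun hd =>
    h2 ⟨i + 1, revKjdt_dot_of_neighbor hd (Or.inr (Or.inr (Or.inl ⟨by omega, by simpa using hi⟩)))⟩
  refine ⟨i, hi, ?_, fun k hk => ?_⟩
  · by_contra hr
    refine h2 ⟨i, ?_⟩
    unfold Tableau.revKjdt
    rw [if_neg (by simp [hi]), if_neg, hi]
    rintro ⟨_, hn⟩
    rcases hn with hn | hn | ⟨h0, hn⟩ | ⟨h0, hn⟩
    · exact hbelow hn
    · exact hr hn
    · refine hT.dot_ne_below hn ?_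
      rwa [show i - 1 + 1 = i by omega]
    · refine hT.dot_ne_right hn ?_
      rwa [show c - 1 + 1 = c by omega]
  -- No entry fits strictly between `m` and `•`, so a `•` in this column would be directly below
  -- `m`.
  · have hik : i < k := hT.row_lt_of_val_lt (c := c) (by simp [hi]) (by rw [hi, hk]; simp [dotVal])
    rcases Nat.lt_or_ge (i + 1) k with hlt | hge
    · have hkh := hT.lt_of_ne (i := k) (c := c) (by simp [hk])
      have l1 := hT.down i c (by omega) (by simp [hi])
      have l2 := hT.col_lt hlt hkh (dotVal_pos.1 (Nat.zero_lt_of_lt l1))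
      rw [hi] at l1
      rw [hk] at l2
      simp only [dotVal] at l1 l2
      omega
    · obtain rfl : k = i + 1 := by omega
      exact hbelow hk

/-- The domination conditions are matchings along rows. For a gain, the rows above the `•` pair
entries below `m` with right neighbours below `m`. For a loss, the rows below the `•` pair entries
above `m` with left neighbours above `m`, which are numbers because the column has no `•`. -/
theorem keyCount_revKjdt (hT : IsDotted h N m T) {j : ℕ} (hj : h (j + 1) = 0) :
    keyCount (colSet (Tableau.revKjdt m T)) j = keyCount (colSet T) j := by
  refine keyCount_eq_of_move hT.colSet_finite (fun c x hx => mem_colSet_revKjdt_of_ne hx) ?_ ?_ ?_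
  · intro c h1 h2
    obtain ⟨i, d, rfl, hm, hd⟩ := hT.exists_of_gain h1 h2
    refine ⟨d, rfl, ⟨i, hm⟩, fun u _ => ?_⟩
    refine countIn_le_of_rel (fun x y => ∃ k, T k d = .num x ∧ T k (d + 1) = .num y) ?_ ?_
    · rintro x ⟨k, hk⟩ hux hxm
      have hki : k < i := hT.row_lt_of_val_lt (c := d) (by simp [hk]) (by
        rw [hk, hm]; simp only [dotVal]; omega)
      have hih := hT.lt_of_ne (i := i) (c := d + 1) (by simp [hd])
      have l1 := hT.right k d (by omega) (by simp [hk])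
      have l2 := hT.col_lt hki hih (dotVal_pos.1 (Nat.zero_lt_of_lt l1))
      rw [hk] at l1
      rw [hd] at l2
      rcases hy : T k (d + 1) with _ | _ | y
      · simp [hy, dotVal] at l1
      · simp [hy, dotVal] at l2
      · simp only [hy, dotVal] at l1 l2
        have hym : y ≠ m := fun e => h2 ⟨k, e ▸ hy⟩
        exact ⟨y, ⟨k, hy⟩, by omega, by omega, k, hk, hy⟩
    · rintro x x' y ⟨k, h3, h4⟩ ⟨k', h5, h6⟩
      obtain rfl := hT.row_unique (by simp [h4]) (h4.trans h6.symm)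
      simpa using h3.symm.trans h5
  · intro c h1 h2 u _
    obtain ⟨i, hm, hd, hnd⟩ := hT.exists_of_loss h1 h2
    refine countIn_le_of_rel (fun x y => ∃ k, T k (c + 1) = .num x ∧ T k c = .num y) ?_ ?_
    · rintro x ⟨k, hk⟩ hmx hxu
      have hik : i < k := hT.row_lt_of_val_lt (c := c + 1) (by simp [hd]) (by
        rw [hk, hd]; simp only [dotVal]; omega)
      have hkh := hT.lt_of_ne (i := k) (c := c + 1) (by simp [hk])
      have l1 := hT.col_lt hik (hkh.trans_le (hT.anti (Nat.le_succ c))) (by simp [hm])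
      have l2 := hT.right k c hkh (dotVal_pos.1 (Nat.zero_lt_of_lt l1))
      rw [hm] at l1
      rw [hk] at l2
      rcases hy : T k c with _ | _ | y
      · simp [hy, dotVal] at l1
      · exact absurd hy (hnd k)
      · simp only [hy, dotVal] at l1 l2
        exact ⟨y, ⟨k, hy⟩, by omega, by omega, k, hk, hy⟩
    · rintro x x' y ⟨k, h3, h4⟩ ⟨k', h5, h6⟩
      obtain rfl := hT.row_unique (by simp [h4]) (h4.trans h6.symm)
      simpa using h3.symm.trans h5
  · intro h1
    by_contra h2
    obtain ⟨i, _, hd, _⟩ := hT.exists_of_loss h1 h2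
    have := hT.lt_of_ne (i := i) (c := j + 1) (by simp [hd])
    omega

theorem revKjdtAll (hT : IsDotted h N m T) (hm : m ≤ N) {j : ℕ} (hj : h (j + 1) = 0) :
    IsDotted h N 0 (Tableau.revKjdtAll m T) ∧
      keyCount (colSet (Tableau.revKjdtAll m T)) j = keyCount (colSet T) j := by
  induction m generalizing T with
  | zero => exact ⟨hT, rfl⟩
  | succ m ih =>
    obtain ⟨h1, h2⟩ := ih (hT.revKjdt hm) (by omega)
    exact ⟨h1, h2.trans (hT.keyCount_revKjdt hj)⟩

end IsDotted

/-! ### Rounds of anti-rectification -/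

/-- An increasing skew tableau with outer column lengths `h` and entries in `[1, N]`. -/
structure IsSkew (h : ℕ → ℕ) (N : ℕ) (T : DotFilling) : Prop extends IsDotted h N N T where
  ne_dot : ∀ i c, T i c ≠ .dot

theorem colSet_removeDots (T : DotFilling) : colSet (removeDots T) = colSet T := by
  funext c
  ext x
  constructor
  · rintro ⟨i, hi⟩
    unfold removeDots at hi
    split_ifs at hi
    exact ⟨i, hi⟩
  · rintro ⟨i, hi⟩
    exact ⟨i, by simp [removeDots, hi]⟩

/-- After all moves `•` is smaller than every number, so no number has a `•` to its right or below
it, and erasing the `•` leaves a skew tableau. -/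
theorem IsDotted.removeDots {h : ℕ → ℕ} {N : ℕ} {T : DotFilling} (hT : IsDotted h N 0 T) :
    IsSkew h N (removeDots T) := by
  have aux : ∀ i c i' c', (T i c ≠ .empty → dotVal 0 (T i c) < dotVal 0 (T i' c')) →
      Tableau.removeDots T i c ≠ .empty →
      dotVal N (Tableau.removeDots T i c) < dotVal N (Tableau.removeDots T i' c') := by
    intro i c i' c' hlt hne
    rcases h1 : T i c with _ | _ | x
    · simp [Tableau.removeDots, h1] at hne
    · simp [Tableau.removeDots, h1] at hne
    · have hx := hT.bound i c x h1
      have hlt' := hlt (by simp [h1])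
      rcases h2 : T i' c' with _ | _ | y
      · simp [h1, h2, dotVal] at hlt'
      · simp only [h1, h2, dotVal] at hlt'
        omega
      · simpa [Tableau.removeDots, h1, h2, dotVal] using hlt'
  refine ⟨⟨hT.anti, ?_, ?_, ?_, ?_⟩, ?_⟩
  · intro i c hi
    simp [Tableau.removeDots, hT.out i c hi]
  · intro i c x hx
    unfold Tableau.removeDots at hx
    split_ifs at hx
    exact hT.bound i c x hx
  · exact fun i c hi => aux _ _ _ _ (hT.right i c hi)
  · exact fun i c hi => aux _ _ _ _ (hT.down i c hi)
  · intro i c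
    unfold Tableau.removeDots
    split_ifs with h1
    · simp
    · exact h1

theorem antitone_update_succ {h : ℕ → ℕ} (hh : Antitone h) {c : ℕ}
    (hc : c = 0 ∨ h c + 1 ≤ h (c - 1)) : Antitone (Function.update h c (h c + 1)) := by
  refine antitone_nat_of_succ_le fun n => ?_
  have := hh (Nat.le_succ n)
  simp only [Nat.succ_eq_add_one] at this
  by_cases h1 : n + 1 = c
  · subst h1
    rw [Function.update_self, Function.update_of_ne (by omega)]
    simpa using hc
  · rw [Function.update_of_ne h1]
    by_cases h2 : n = c
    · subst h2; rw [Function.update_self]; omega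
    · rw [Function.update_of_ne h2]; exact this

/-- At the start of a round `•` counts as larger than all entries, so it may be placed at an outer
corner. Condition `hc` keeps the outer shape a partition. -/
theorem IsSkew.round {h : ℕ → ℕ} {N : ℕ} {T : DotFilling} (hT : IsSkew h N T) {c j : ℕ}
    (hc : c = 0 ∨ h c + 1 ≤ h (c - 1)) (hcj : c ≤ j) (hj : h (j + 1) = 0) :
    IsSkew (Function.update h c (h c + 1)) N (antiRectifyRound N T (h c, c)) ∧
      keyCount (colSet (antiRectifyRound N T (h c, c))) j = keyCount (colSet T) j := by
  set h' := Function.update h c (h c + 1) with hh'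
  have hself : h' c = h c + 1 := Function.update_self ..
  have hne : ∀ d, d ≠ c → h' d = h d := fun d hd => Function.update_of_ne hd ..
  have hlt : ∀ i d, i < h' d → (i, d) ≠ (h c, c) → i < h d := fun i d hi hd => by
    by_cases hdc : d = c
    · subst hdc
      have : i ≠ h d := fun e => hd (by rw [e])
      omega
    · rwa [hne d hdc] at hi
  have hval : ∀ i d, T i d ≠ .empty → dotVal N (T i d) < 2 * N + 2 := fun i d hi => by
    rcases h1 : T i d with _ | _ | x
    · exact absurd h1 hi
    · exact absurd h1 (hT.ne_dot i d)
    · have := hT.bound i d x h1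
      simp only [dotVal]; omega
  have hdot : IsDotted h' N N (addDot T (h c, c)) := by
    refine ⟨antitone_update_succ hT.anti hc, ?_, ?_, ?_, ?_⟩
    · intro i d hi
      unfold addDot
      rw [if_neg]
      · refine hT.out i d (le_trans ?_ hi)
        by_cases hdc : d = c
        · subst hdc; omega
        · exact (hne d hdc).ge
      · intro e
        obtain ⟨rfl, rfl⟩ := Prod.mk.inj e
        omega
    · intro i d x hx
      unfold addDot at hx
      split_ifs at hx
      exact hT.bound i d x hx
    · intro i d hi hemp
      have hp : (i, d) ≠ (h c, c) := fun e => by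
        obtain ⟨rfl, rfl⟩ := Prod.mk.inj e
        rw [hne _ (by omega)] at hi
        have := hT.anti (Nat.le_succ d)
        simp only [Nat.succ_eq_add_one] at this
        omega
      unfold addDot at hemp ⊢
      rw [if_neg hp] at hemp ⊢
      split_ifs with h2
      · exact hval i d hemp
      · exact hT.right i d (hlt _ _ hi h2) hemp
    · intro i d hi hemp
      have hp : (i, d) ≠ (h c, c) := fun e => by
        obtain ⟨rfl, rfl⟩ := Prod.mk.inj e
        omega
      unfold addDot at hemp ⊢
      rw [if_neg hp] at hemp ⊢
      split_ifs with h2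
      · exact hval i d hemp
      · exact hT.down i d (hlt _ _ hi h2) hemp
  have hcol : colSet (addDot T (h c, c)) = colSet T := by
    funext d
    ext x
    constructor
    · rintro ⟨i, hi⟩
      unfold addDot at hi
      split_ifs at hi
      exact ⟨i, hi⟩
    · rintro ⟨i, hi⟩
      refine ⟨i, ?_⟩
      unfold addDot
      rw [if_neg, hi]
      intro e
      obtain ⟨rfl, rfl⟩ := Prod.mk.inj e
      rw [hT.out _ _ le_rfl] at hi
      cases hi
  have hj' : h' (j + 1) = 0 := by rw [hne _ (by omega), hj]
  obtain ⟨h1, h2⟩ := hdot.revKjdtAll le_rfl hj'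
  refine ⟨h1.removeDots, ?_⟩
  rw [antiRectifyRound, colSet_removeDots, h2, hcol]

theorem IsSkew.foldl_column {N c j : ℕ} (n : ℕ) {h : ℕ → ℕ} {T : DotFilling} (hT : IsSkew h N T)
    (hc : c = 0 ∨ h c + n ≤ h (c - 1)) (hcj : c ≤ j) (hj : h (j + 1) = 0) :
    IsSkew (Function.update h c (h c + n)) N
        (((List.range' (h c) n).map fun i => (i, c)).foldl (antiRectifyRound N) T) ∧
      keyCount (colSet (((List.range' (h c) n).map fun i => (i, c)).foldl
        (antiRectifyRound N) T)) j = keyCount (colSet T) j := by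
  induction n generalizing h T with
  | zero => simpa using hT
  | succ n ih =>
    obtain ⟨h1, h2⟩ := hT.round (c := c) (j := j) (by omega) hcj hj
    have h3 := ih h1 (by
      rw [Function.update_self]
      rcases Nat.eq_zero_or_pos c with h0 | h0
      · exact Or.inl h0
      · rw [Function.update_of_ne (by omega)]; omega)
      (by rw [Function.update_of_ne (by omega), hj])
    rw [Function.update_self, Function.update_idem, h2,
      show h c + 1 + n = h c + (n + 1) by omega] at h3
    rw [List.range'_succ, List.map_cons, List.foldl_cons]
    exact h3

/-! ### The left key of an increasing tableau -/

/-- The set of numbers in column `c`. -/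
def col (P : Tableau) (c : ℕ) : Set ℕ := {x | ∃ i, (i, c) ∈ P.shape ∧ P.entry i c = x}

theorem colSet_firstColumns (P : Tableau) {j c : ℕ} (hc : c ≤ j) :
    colSet (P.firstColumns j) c = P.col c := by
  ext x
  constructor
  · rintro ⟨i, hi⟩
    unfold firstColumns at hi
    split_ifs at hi with h1
    exact ⟨i, h1.1, by simpa using hi⟩
  · rintro ⟨i, h1, rfl⟩
    exact ⟨i, by simp [firstColumns, h1, hc]⟩

theorem IsIncreasing.isSkew_firstColumns {P : Tableau} (hP : P.IsIncreasing) (j : ℕ) :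
    IsSkew (fun c => if c ≤ j then P.shape.colLen c else 0) P.maxEntry (P.firstColumns j) := by
  have hnum : ∀ i c, P.firstColumns j i c ≠ .empty →
      (i, c) ∈ P.shape ∧ P.firstColumns j i c = .num (P.entry i c) := fun i c h => by
    unfold firstColumns at h ⊢
    split_ifs at h ⊢ with h1
    · exact ⟨h1.1, rfl⟩
    · exact absurd rfl h
  have hin : ∀ i c, i < (if c ≤ j then P.shape.colLen c else 0) →
      (i, c) ∈ P.shape ∧ P.firstColumns j i c = .num (P.entry i c) := fun i c h => by
    split_ifs at h with h1
    · have h2 := YoungDiagram.mem_iff_lt_colLen.2 h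
      exact ⟨h2, by simp [firstColumns, h1, h2]⟩
    · omega
  refine ⟨⟨?_, ?_, ?_, ?_, ?_⟩, ?_⟩
  · intro a b hab
    dsimp only
    have := P.shape.colLen_anti a b hab
    split_ifs <;> omega
  · intro i c hi
    unfold firstColumns
    rw [if_neg]
    rintro ⟨h1, h2⟩
    rw [if_pos h2] at hi
    exact absurd (YoungDiagram.mem_iff_lt_colLen.1 h1) (not_lt.2 hi)
  · intro i c x hx
    obtain ⟨h1, h2⟩ := hnum i c (by simp [hx])
    rw [h2] at hx
    cases hx
    exact ⟨hP.pos i c h1, Finset.le_sup (f := fun p : ℕ × ℕ => P.entry p.1 p.2) (b := (i, c))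
      ((YoungDiagram.mem_cells _).2 h1)⟩
  · intro i c hi hne
    obtain ⟨h1, h2⟩ := hin i (c + 1) hi
    rw [(hnum i c hne).2, h2]
    have := hP.row_lt i c (c + 1) (Nat.lt_succ_self c) h1
    simp only [dotVal]; omega
  · intro i c hi hne
    obtain ⟨h1, h2⟩ := hin (i + 1) c hi
    rw [(hnum i c hne).2, h2]
    have := hP.col_lt i (i + 1) c (Nat.lt_succ_self i) h1
    simp only [dotVal]; omega
  · intro i c
    unfold firstColumns
    split_ifs <;> simp

theorem IsIncreasing.antiRectify {P : Tableau} (hP : P.IsIncreasing) (j : ℕ) :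
    IsSkew (fun c => if c ≤ j then P.numRows else 0) P.maxEntry (P.antiRectify j) ∧
      keyCount (colSet (P.antiRectify j)) j = keyCount P.col j := by
  -- Induction on the number `k` of full columns. Column `k` can be filled to the bottom because its
  -- left neighbour, if any, is full.
  have main : ∀ k, k ≤ j + 1 →
      IsSkew (fun c => if c ≤ j then if c < k then P.numRows else P.shape.colLen c else 0)
        P.maxEntry (((List.range k).flatMap fun c =>
          (List.range' (P.shape.colLen c) (P.numRows - P.shape.colLen c)).map
            fun i => (i, c)).foldl (antiRectifyRound P.maxEntry) (P.firstColumns j)) ∧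
      keyCount (colSet (((List.range k).flatMap fun c =>
          (List.range' (P.shape.colLen c) (P.numRows - P.shape.colLen c)).map
            fun i => (i, c)).foldl (antiRectifyRound P.maxEntry) (P.firstColumns j))) j =
        keyCount P.col j := by
    intro k
    induction k with
    | zero =>
      intro _
      refine ⟨?_, keyCount_congr fun d hd => colSet_firstColumns P hd⟩
      simpa using hP.isSkew_firstColumns j
    | succ k ih =>
      intro hk
      obtain ⟨h1, h2⟩ := ih (by omega)
      have hlen : P.shape.colLen k ≤ P.numRows := P.shape.colLen_anti 0 k (Nat.zero_le k)
      have h3 := h1.foldl_column (c := k) (j := j) (P.numRows - P.shape.colLen k) (by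
        rcases Nat.eq_zero_or_pos k with h0 | h0
        · exact Or.inl h0
        · right
          rw [if_pos (by omega), if_neg (by omega), if_pos (by omega), if_pos (by omega)]
          omega) (by omega) (by simp)
      have hkk : (if k ≤ j then if k < k then P.numRows else P.shape.colLen k else 0) =
          P.shape.colLen k := by rw [if_pos (by omega), if_neg (by omega)]
      rw [hkk, h2] at h3
      rw [List.range_succ, List.flatMap_append, List.foldl_append, List.flatMap_singleton]
      refine ⟨?_, h3.2⟩
      convert h3.1 using 1
      funext c
      by_cases hc : c = k
      · subst hc
        rw [Function.update_self, if_pos (by omega), if_pos (by omega)]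
        omega
      · rw [Function.update_of_ne hc]
        have : c < k + 1 ↔ c < k := by omega
        simp only [this]
  obtain ⟨h1, h2⟩ := main (j + 1) le_rfl
  refine ⟨?_, h2⟩
  have hh : (fun c => if c ≤ j then P.numRows else 0) =
      fun c => if c ≤ j then if c < j + 1 then P.numRows else P.shape.colLen c else 0 := by
    funext c
    split_ifs <;> omega
  rw [hh]
  exact h1

/-- The left key through slides of the columns. -/
theorem IsIncreasing.leftKey_eq {P : Tableau} (hP : P.IsIncreasing) (j : ℕ) :
    P.leftKey j = stepSet (keyCount P.col j) := by
  by_cases hj : j < P.numCols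
  · obtain ⟨h1, h2⟩ := hP.antiRectify j
    -- In the rectangle every number left of column `j` has a larger number to its right, so each
    -- column slides onto the previous one entirely.
    have main : ∀ k c, c + k = j → slideAll (colSet (P.antiRectify j)) c k
        (tailCount (colSet (P.antiRectify j) j)) = tailCount (colSet (P.antiRectify j) c) := by
      intro k
      induction k with
      | zero => rintro c rfl; rfl
      | succ k ih =>
        intro c hc
        rw [slideAll, ih (c + 1) (by omega)]
        refine slide_tailCount_of_le (h1.colSet_finite c) (fun u => ?_) (h1.colSet_finite _)
        refine ncard_le_ncard_of_rel ((h1.colSet_finite _).inter_of_left _)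
          (fun x y => ∃ i, P.antiRectify j i c = .num x ∧ P.antiRectify j i (c + 1) = .num y) ?_ ?_
        · rintro x ⟨⟨i, hi⟩, hux⟩
          have hlt := h1.lt_of_ne (i := i) (c := c) (by simp [hi])
          rw [if_pos (by omega)] at hlt
          have l := h1.right i c (by rwa [if_pos (by omega)]) (by simp [hi])
          rcases hy : P.antiRectify j i (c + 1) with _ | _ | y
          · simp [hy, dotVal] at l
          · exact absurd hy (h1.ne_dot _ _)
          · simp only [hi, hy, dotVal] at l
            have : u ≤ x := hux
            exact ⟨y, ⟨⟨i, hy⟩, show u + 1 ≤ y by omega⟩, i, hi, hy⟩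
        · rintro x x' y ⟨k, h3, h4⟩ ⟨k', h5, h6⟩
          obtain rfl := h1.row_unique (by simp [h4]) (h4.trans h6.symm)
          simpa using h3.symm.trans h5
    rw [← h2, keyCount, main j 0 (by omega), stepSet_tailCount (h1.colSet_finite 0)]
    ext x
    exact ⟨fun h => h.2, fun h => ⟨hj, h⟩⟩
  · have hcol : ∀ t, tailCount (P.col j) t = 0 := fun t => by
      refine tailCount_eq_zero ?_
      rintro x ⟨i, hi, _⟩
      have h1 := P.shape.up_left_mem (Nat.zero_le i) le_rfl hi
      exact absurd (YoungDiagram.mem_iff_lt_rowLen.1 h1) hj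
    rw [keyCount, show tailCount (P.col j) = fun _ => 0 from funext hcol, slideAll_zero]
    ext x
    simp only [stepSet, Set.mem_ofPred_eq, lt_irrefl, iff_false]
    exact fun h => hj h.1

/-! ### Changes of a single column -/

theorem slideAll_le {A : ℕ → Set ℕ} (c k : ℕ) {g : ℕ → ℕ} (hg : Antitone g) (t : ℕ) :
    slideAll A c k g t ≤ g t := by
  induction k generalizing c with
  | zero => exact le_rfl
  | succ k ih =>
    refine (slide_le _ _ le_rfl).trans ?_
    rw [countIn_self, Nat.zero_add]
    exact (slideAll_antitone A (c + 1) k hg (Nat.le_succ t)).trans (ih (c + 1))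

theorem keyCount_diff {A : ℕ → Set ℕ} (hA : ∀ c, (A c).Finite) {q j m : ℕ} (hq : q < j)
    (hAB : ∀ u, m < u → countIn (A (q + 1)) (m + 1) (u + 1) ≤ countIn (A q) (m + 1) u) :
    keyCount (Function.update A q (A q \ {m})) j = keyCount A j := by
  obtain ⟨k, rfl⟩ : ∃ k, j = q + (k + 1) := ⟨j - q - 1, by omega⟩
  have hne : ∀ d, d ≠ q → Function.update A q (A q \ {m}) d = A d := fun d hd =>
    Function.update_of_ne hd ..
  rw [keyCount_split, keyCount_split,
    slideAll_congr (fun d _ h2 => hne d (by omega)) (slideAll _ q (k + 1) _), slideAll, slideAll,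
    slideAll_congr (fun d h1 _ => hne d (by omega)), Function.update_self, hne _ (by omega),
    slide_diff_singleton (B := A (q + 1)) (countBound_slideAll _ _ _) hAB]
  rw [show q + 1 + k = q + (k + 1) by omega]
  exact countBound_tailCount (hA _)

theorem keyCount_insert {A : ℕ → Set ℕ} (hA : ∀ c, (A c).Finite) {d j x : ℕ} (hq : d + 1 ≤ j)
    (hAB : ∀ u, u < x → countIn (A d) u x ≤ countIn (A (d + 1)) (u + 1) x) :
    keyCount (Function.update A (d + 1) (insert x (A (d + 1)))) j = keyCount A j := by
  obtain ⟨k, rfl⟩ : ∃ k, j = d + (k + 1) := ⟨j - d - 1, by omega⟩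
  have hne : ∀ e, e ≠ d + 1 → Function.update A (d + 1) (insert x (A (d + 1))) e = A e :=
    fun e he => Function.update_of_ne he ..
  rw [keyCount_split, keyCount_split,
    slideAll_congr (fun e _ h2 => hne e (by omega)) (slideAll _ d (k + 1) _), slideAll, slideAll,
    hne d (by omega)]
  congr 1
  cases k with
  | zero =>
    rw [slideAll, slideAll, Nat.zero_add, Function.update_self]
    exact slide_tailCount_insert (hA _) hAB
  | succ k =>
    rw [slideAll, slideAll, slideAll_congr (fun e h1 _ => hne e (by omega)), Function.update_self,
      hne _ (by omega)]
    exact slide_slide_insert _ hAB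

/-- Unlike an insertion, the swap is only needed for the key column of the same index, where the
changed column is the last one and its own counting function is slid. -/
theorem keyCount_swap {A : ℕ → Set ℕ} (hA : ∀ c, (A c).Finite) {d m x : ℕ} (hmx : m < x)
    (hm : m ∈ A (d + 1)) (hx : x ∉ A (d + 1))
    (hAB : ∀ u, u < x → countIn (A d) u x ≤ countIn (A (d + 1)) (u + 1) x) :
    keyCount (Function.update A (d + 1) (insert x (A (d + 1) \ {m}))) (d + 1) =
      keyCount A (d + 1) := by
  have hne : ∀ e, e ≠ d + 1 → Function.update A (d + 1) (insert x (A (d + 1) \ {m})) e = A e :=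
    fun e he => Function.update_of_ne he ..
  rw [keyCount_split, keyCount_split, slideAll_congr (fun e _ h2 => hne e (by omega)), slideAll,
    slideAll, hne d (by omega), slideAll, slideAll, Function.update_self,
    slide_tailCount_swap (hA _) hmx hm hx fun u _ h => hAB u h]

theorem keyCount_le_of_last {A B : ℕ → Set ℕ} {j : ℕ} (h : ∀ d, d < j → A d = B d)
    (hj : ∀ t, tailCount (A j) t ≤ tailCount (B j) t) (t : ℕ) :
    keyCount A j t ≤ keyCount B j t := by
  rw [keyCount, keyCount, slideAll_congr (B := B) fun d _ h2 => h d (by omega)]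
  exact slideAll_mono _ _ _ hj t

theorem tailCount_lt_of_dominated {B B' : Set ℕ} (hB : B.Finite) (hB' : B'.Finite) {m : ℕ}
    (hm : m ∈ B) (h1 : ∀ u, countIn B' 0 (u + 1) ≤ countIn (B \ {m}) 0 u) :
    tailCount B' 0 < tailCount B 0 := by
  obtain ⟨n, hn⟩ := (hB.union hB').bddAbove
  have hz : ∀ x ∈ B, x < n + 1 := fun x hx => Nat.lt_succ_of_le (hn (Or.inl hx))
  have hz' : ∀ x ∈ B', x < n + 1 + 1 := fun x hx =>
    (Nat.lt_succ_of_le (hn (Or.inr hx))).trans (Nat.lt_succ_self _)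
  have e1 := tailCount_eq hB' (Nat.zero_le (n + 1 + 1))
  have e2 := tailCount_eq hB (Nat.zero_le (n + 1))
  rw [tailCount_eq_zero hz'] at e1
  rw [tailCount_eq_zero hz] at e2
  have hlt : countIn (B \ {m}) 0 (n + 1) < countIn B 0 (n + 1) := by
    refine Set.ncard_lt_ncard ?_ ((Set.finite_Ico _ _).inter_of_right _)
    refine ⟨fun x hx => ⟨hx.1.1, hx.2⟩, fun h => ?_⟩
    exact (h ⟨hm, Nat.zero_le _, hz m hm⟩).1.2 rfl
  have := h1 (n + 1)
  omega

/-- The set `B` without `m`, in terms of the subset of `B` matched with `B'`, where `m` is the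
smallest element of `B` that is not matched. -/
theorem tailCount_diff_eq_min {B B' : Set ℕ} (hB : B.Finite) (hB' : B'.Finite) {m n : ℕ}
    (hm : m ∈ B) (h1 : ∀ u, countIn B' 0 (u + 1) ≤ countIn (B \ {m}) 0 u)
    (h2 : countIn B 0 m ≤ countIn B' 0 (m + 1))
    (hn : tailCount B 0 = tailCount B' 0 + n + 1) :
    tailCount (B \ {m}) = fun t => min (tailCount B t) (slide B (tailCount B') t + n) := by
  have hD : (B \ {m}).Finite := hB.sdiff
  have c1 : ∀ a b, m < a ∨ b ≤ m → countIn (B \ {m}) a b = countIn B a b := fun a b h =>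
    countIn_congr fun x h1 h2 => by
      simp only [Set.mem_sdiff, Set.mem_singleton_iff, and_iff_left_iff_imp]
      intro _; omega
  have c2 : ∀ t, m < t → tailCount (B \ {m}) t = tailCount B t := fun t h =>
    tailCount_congr fun x hx => by
      simp only [Set.mem_sdiff, Set.mem_singleton_iff, and_iff_left_iff_imp]
      intro _; omega
  have c3 : tailCount (B \ {m}) m + 1 = tailCount B m := by
    rw [tailCount_eq hD (Nat.le_add_right m 1), tailCount_eq hB (Nat.le_add_right m 1),
      c2 _ (by omega), countIn_succ_of_mem hm, countIn_succ_of_notMem (fun h => h.2 rfl)]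
    omega
  have c4 : ∀ t, t ≤ m → tailCount (B \ {m}) t + 1 = tailCount B t := fun t h => by
    rw [tailCount_eq hD h, tailCount_eq hB h, c1 _ _ (Or.inr le_rfl)]
    omega
  have c5 : ∀ u, tailCount (B \ {m}) u ≤ tailCount B' (u + 1) + n := fun u => by
    have e1 := tailCount_eq hD (Nat.zero_le u)
    have e2 := tailCount_eq hB' (Nat.zero_le (u + 1))
    have e3 := c4 0 (Nat.zero_le _)
    have e4 := h1 u
    omega
  funext t
  have hlow : tailCount (B \ {m}) t ≤ slide B (tailCount B') t + n := by
    refine le_trans (le_slide fun u hu => ?_) (congrFun (slide_add_const B (tailCount B') n) t).le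
    rw [tailCount_eq hD hu]
    exact Nat.add_le_add (countIn_mono fun x hx h1 h2 => ⟨hx.1, h1, h2⟩) (c5 u)
  rcases le_or_gt t m with h | h
  -- For `t ≤ m` the cut at `m` makes the second term at most `tailCount B t - 1`, by `h2` and the
  -- sizes; `hlow` gives the other inequality.
  · have e1 := slide_le B (tailCount B') h
    have e2 := c4 t h
    have e3 := tailCount_eq hB h
    have e4 := tailCount_eq hB (Nat.zero_le m)
    have e5 := tailCount_eq hB' (Nat.zero_le (m + 1))
    omega
  · rw [c2 t h] at hlow ⊢
    exact (min_eq_left hlow).symm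

/-- If `g` and `h` are the counting functions of a set and of a subset with `n + 1` fewer elements,
then `min g (h + n)` is the counting function of the set without the smallest element outside the
subset. -/
theorem isLeast_stepSet {g h : ℕ → ℕ} {n : ℕ} (hg : ∀ t, g t ≤ g (t + 1) + 1)
    (hh : Antitone h) (hsub : ∀ t u, t ≤ u → g u + h t ≤ g t + h u) (h0 : g 0 = h 0 + n + 1)
    (hz : ∃ t, g t = 0) :
    ∃ y, IsLeast (stepSet g \ stepSet h) y ∧
      stepSet (fun t => min (g t) (h t + n)) = stepSet g \ {y} := by
  classical
  -- `g - h` decreases from `n + 1`; the first `t` at which it is at most `n` is `y + 1`. Up to `y`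
  -- the minimum is `h + n = g - 1`, after `y` it is `g`.
  have hex : ∃ t, g t ≤ h t + n := hz.imp fun t ht => by omega
  obtain ⟨y, hy⟩ : ∃ y, Nat.find hex = y + 1 := by
    refine Nat.exists_eq_succ_of_ne_zero fun h1 => ?_
    have := Nat.find_spec hex
    rw [h1] at this
    omega
  have hle : ∀ t, t ≤ y → g t = h t + n + 1 := fun t ht => by
    have h1 := Nat.find_min hex (m := t) (by omega)
    have h2 := hsub 0 t (Nat.zero_le t)
    omega
  have hgt : ∀ t, y < t → g t ≤ h t + n := fun t ht => by
    have h1 := Nat.find_spec hex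
    rw [hy] at h1
    have h2 := hsub (y + 1) t ht
    omega
  have hy0 := hle y le_rfl
  have hy1 := hgt (y + 1) (Nat.lt_succ_self y)
  have hy2 := hg y
  have hy3 := hh (Nat.le_succ y)
  simp only [Nat.succ_eq_add_one] at hy3
  refine ⟨y, ⟨⟨?_, ?_⟩, ?_⟩, ?_⟩
  · change g (y + 1) < g y
    omega
  · change ¬ h (y + 1) < h y
    omega
  · rintro t ⟨h1, h2⟩
    change g (t + 1) < g t at h1
    change ¬ h (t + 1) < h t at h2
    by_contra hlt
    have e1 := hle t (by omega)
    have e2 := hle (t + 1) (by omega)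
    omega
  · ext t
    simp only [stepSet, Set.mem_ofPred_eq, Set.mem_sdiff, Set.mem_singleton_iff]
    rcases lt_trichotomy t y with hlt | rfl | hlt
    · have e1 := hle t (by omega)
      have e2 := hle (t + 1) (by omega)
      omega
    · omega
    · have e1 := hgt t (by omega)
      have e2 := hgt (t + 1) (by omega)
      omega

/-! ### Columns of increasing tableaux -/

theorem col_finite (P : Tableau) (c : ℕ) : (P.col c).Finite := by
  refine (P.shape.cells.finite_toSet.image fun p => P.entry p.1 p.2).subset ?_
  rintro x ⟨i, hi, rfl⟩
  exact ⟨(i, c), hi, rfl⟩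

namespace IsIncreasing

variable {P : Tableau}

theorem row_unique (hP : P.IsIncreasing) {i i' c : ℕ} (h : (i, c) ∈ P.shape)
    (h' : (i', c) ∈ P.shape) (heq : P.entry i c = P.entry i' c) : i = i' := by
  rcases lt_trichotomy i i' with hlt | rfl | hlt
  · have := hP.col_lt i i' c hlt h'; omega
  · rfl
  · have := hP.col_lt i' i c hlt h; omega

theorem row_le (hP : P.IsIncreasing) {i c c' : ℕ} (hc : c ≤ c') (h : (i, c') ∈ P.shape) :
    P.entry i c ≤ P.entry i c' := by
  rcases hc.eq_or_lt with rfl | hlt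
  · exact le_rfl
  · exact (hP.row_lt i c c' hlt h).le

theorem col_le (hP : P.IsIncreasing) {i i' c : ℕ} (hi : i ≤ i') (h : (i', c) ∈ P.shape) :
    P.entry i c ≤ P.entry i' c := by
  rcases hi.eq_or_lt with rfl | hlt
  · exact le_rfl
  · exact (hP.col_lt i i' c hlt h).le

theorem countIn_col_succ_le (hP : P.IsIncreasing) (c u : ℕ) :
    countIn (P.col (c + 1)) 0 (u + 1) ≤ countIn (P.col c) 0 u := by
  refine countIn_le_of_rel
    (fun x y => ∃ k, (k, c + 1) ∈ P.shape ∧ P.entry k (c + 1) = x ∧ P.entry k c = y) ?_ ?_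
  · rintro x ⟨k, hk, rfl⟩ _ hx
    have hk' := P.shape.up_left_mem le_rfl (Nat.le_succ c) hk
    have := hP.row_lt k c (c + 1) (Nat.lt_succ_self c) hk
    exact ⟨P.entry k c, ⟨k, hk', rfl⟩, Nat.zero_le _, by omega, k, hk, rfl, rfl⟩
  · rintro x x' y ⟨k, h1, rfl, h2⟩ ⟨k', h3, rfl, h4⟩
    rw [hP.row_unique (P.shape.up_left_mem le_rfl (Nat.le_succ c) h1)
      (P.shape.up_left_mem le_rfl (Nat.le_succ c) h3) (h2.trans h4.symm)]

theorem keyCount_col_zero (hP : P.IsIncreasing) (j : ℕ) :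
    keyCount P.col j 0 = tailCount (P.col j) 0 := by
  refine slideAll_apply_zero 0 j ?_ (tailCount_antitone (P.col_finite j))
    fun d _ _ => hP.countIn_col_succ_le d
  rw [Nat.zero_add]
  exact countBound_tailCount (P.col_finite j)

/-- The column `j` of the left key without the smallest element outside the column `j + 1`. -/
theorem exists_isLeast_leftKey (hP : P.IsIncreasing) {j n : ℕ}
    (hn : tailCount (P.col j) 0 = tailCount (P.col (j + 1)) 0 + n + 1) :
    ∃ y, IsLeast (P.leftKey j \ P.leftKey (j + 1)) y ∧
      stepSet (fun t => min (keyCount P.col j t) (keyCount P.col (j + 1) t + n)) =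
        P.leftKey j \ {y} := by
  rw [hP.leftKey_eq, hP.leftKey_eq]
  have hanti := tailCount_antitone (P.col_finite j)
  have hanti' := tailCount_antitone (P.col_finite (j + 1))
  have hb : CountBound (P.col 0) (keyCount P.col j) :=
    countBound_slideAll 0 j (by rw [Nat.zero_add]; exact countBound_tailCount (P.col_finite j))
  refine isLeast_stepSet hb.succ_le (slideAll_antitone _ _ _ hanti') ?_ ?_ ?_
  -- Column `j + 1` slid into column `j` is a part of that column, and the further slides preserve
  -- this inclusion.
  · rw [keyCount_split P.col j 1]
    refine slideAll_sub_antitone P.col 0 j hanti (slideAll_antitone _ _ _ hanti') ?_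
    intro t u htu
    have h1 := tailCount_eq (P.col_finite j) htu
    have h2 := countBound_slide (P.col j) (tailCount (P.col (j + 1))) t u htu
    change _ + slide (P.col j) (tailCount (P.col (j + 1))) t ≤
      _ + slide (P.col j) (tailCount (P.col (j + 1))) u
    omega
  · rw [hP.keyCount_col_zero, hP.keyCount_col_zero, hn]
  · obtain ⟨b, hb⟩ := (P.col_finite j).bddAbove
    refine ⟨b + 1, Nat.le_zero.1 ((slideAll_le 0 j hanti _).trans_eq (tailCount_eq_zero ?_))⟩
    exact fun x hx => Nat.lt_succ_of_le (hb hx)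

end IsIncreasing

/-! ### The bumping path -/

theorem pathCol_self (P : Tableau) (r c : ℕ) : P.pathCol r c r = c := by
  simp [pathCol, pathColUp]

/-- The cell directly above a path cell is a candidate in the search, since columns increase. Hence
the search succeeds, and going up the path moves weakly to the right. -/
theorem IsIncreasing.pathCol_step {P : Tableau} (hP : P.IsIncreasing) {r c i : ℕ} (hi : i < r)
    (hmem : (i + 1, P.pathCol r c (i + 1)) ∈ P.shape) :
    (i, P.pathCol r c i) ∈ P.shape ∧
    P.entry i (P.pathCol r c i) < P.entry (i + 1) (P.pathCol r c (i + 1)) ∧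
    P.pathCol r c (i + 1) ≤ P.pathCol r c i ∧
    ∀ d, P.pathCol r c i < d → (i, d) ∈ P.shape →
      P.entry (i + 1) (P.pathCol r c (i + 1)) ≤ P.entry i d := by
  obtain ⟨k, hk⟩ : ∃ k, r - i = k + 1 := ⟨r - i - 1, by omega⟩
  have hk1 : r - (i + 1) = k := by omega
  have e1 : r - (k + 1) = i := by omega
  have e2 : r - k = i + 1 := by omega
  have hq : P.pathCol r c i = Nat.findGreatest (fun d => (i, d) ∈ P.shape ∧
      P.entry i d < P.entry (i + 1) (P.pathCol r c (i + 1))) (P.shape.rowLen i) := by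
    rw [pathCol, hk, pathColUp, pathCol, hk1, e1, e2]
  set q := P.pathCol r c (i + 1)
  have h1 : (i, q) ∈ P.shape := P.shape.up_left_mem (Nat.le_succ i) le_rfl hmem
  have h2 : P.entry i q < P.entry (i + 1) q := hP.col_lt i (i + 1) q (Nat.lt_succ_self i) hmem
  have h3 : q ≤ P.shape.rowLen i := (YoungDiagram.mem_iff_lt_rowLen.1 h1).le
  have h4 := Nat.findGreatest_spec (P := fun d => (i, d) ∈ P.shape ∧
    P.entry i d < P.entry (i + 1) q) h3 ⟨h1, h2⟩
  rw [← hq] at h4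
  refine ⟨h4.1, h4.2, ?_, fun d hd hmd => ?_⟩
  · rw [hq]
    exact Nat.le_findGreatest h3 ⟨h1, h2⟩
  · rw [hq] at hd
    have := Nat.findGreatest_is_greatest hd (YoungDiagram.mem_iff_lt_rowLen.1 hmd).le
    exact not_lt.1 fun h => this ⟨hmd, h⟩

theorem IsIncreasing.pathCol_mem {P : Tableau} (hP : P.IsIncreasing) {r c i : ℕ}
    (hmem : (r, c) ∈ P.shape) (hi : i ≤ r) : (i, P.pathCol r c i) ∈ P.shape := by
  induction hi using Nat.decreasingInduction with
  | self => rwa [pathCol_self]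
  | of_succ k hk ih => exact (hP.pathCol_step hk ih).1

/-! ### Replacing an entry -/

theorem setEntry_entry (P : Tableau) (i c x k d : ℕ) :
    (P.setEntry i c x).entry k d = if k = i ∧ d = c then x else P.entry k d := by
  simp only [setEntry, Function.update_apply]
  by_cases h1 : k = i
  · subst h1
    by_cases h2 : d = c <;> simp [h2]
  · simp [h1]

theorem setEntry_entry_self (P : Tableau) (i c x : ℕ) : (P.setEntry i c x).entry i c = x := by
  simp [setEntry_entry]

theorem setEntry_entry_ne (P : Tableau) {i c x k d : ℕ} (h : k ≠ i ∨ d ≠ c) :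
    (P.setEntry i c x).entry k d = P.entry k d := by
  rw [setEntry_entry, if_neg]
  omega

theorem IsIncreasing.setEntry {P : Tableau} (hP : P.IsIncreasing) {i c x : ℕ}
    (hmem : (i, c) ∈ P.shape) (hx : P.entry i c < x)
    (hright : ∀ d, c < d → (i, d) ∈ P.shape → x < P.entry i d)
    (hbelow : (i + 1, c) ∈ P.shape → x < P.entry (i + 1) c) : (P.setEntry i c x).IsIncreasing := by
  refine ⟨?_, ?_, ?_⟩
  · intro k d hk
    rw [setEntry_entry]
    split_ifs
    · omega
    · exact hP.pos k d hk
  · intro k d d' hd hk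
    change (k, d') ∈ P.shape at hk
    have h1 := hP.row_lt k d d' hd hk
    rw [setEntry_entry, setEntry_entry]
    split_ifs with h2 h3 h3
    · omega
    · obtain ⟨rfl, rfl⟩ := h2
      exact hright d' hd hk
    · obtain ⟨rfl, rfl⟩ := h3
      omega
    · exact h1
  · intro k k' d hk hk'
    change (k', d) ∈ P.shape at hk'
    have h1 := hP.col_lt k k' d hk hk'
    rw [setEntry_entry, setEntry_entry]
    split_ifs with h2 h3 h3
    · omega
    · obtain ⟨rfl, rfl⟩ := h2
      exact (hbelow (P.shape.up_left_mem hk le_rfl hk')).trans_le (hP.col_le hk hk')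
    · obtain ⟨rfl, rfl⟩ := h3
      omega
    · exact h1

theorem IsIncreasing.col_setEntry {P : Tableau} (hP : P.IsIncreasing) {i c x : ℕ}
    (hmem : (i, c) ∈ P.shape) :
    (P.setEntry i c x).col =
      Function.update P.col c (insert x (P.col c \ {P.entry i c})) := by
  funext d
  ext y
  by_cases hd : d = c
  · subst hd
    rw [Function.update_self]
    constructor
    · rintro ⟨k, hk, rfl⟩
      by_cases hki : k = i
      · subst hki
        exact Or.inl (setEntry_entry_self ..)
      · rw [setEntry_entry_ne P (Or.inl hki)]
        exact Or.inr ⟨⟨k, hk, rfl⟩, fun e => hki (hP.row_unique hk hmem e)⟩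
    · rintro (rfl | ⟨⟨k, hk, rfl⟩, hne⟩)
      · exact ⟨i, hmem, setEntry_entry_self ..⟩
      · refine ⟨k, hk, setEntry_entry_ne P (Or.inl ?_)⟩
        rintro rfl
        exact hne rfl
  · rw [Function.update_of_ne hd]
    constructor
    · rintro ⟨k, hk, rfl⟩
      exact ⟨k, hk, (setEntry_entry_ne P (Or.inr hd)).symm⟩
    · rintro ⟨k, hk, rfl⟩
      exact ⟨k, hk, setEntry_entry_ne P (Or.inr hd)⟩

theorem mem_removeCell {P : Tableau} {r c : ℕ} (h : P.IsOuter r c) {k d : ℕ} :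
    (k, d) ∈ (P.removeCell r c h).shape ↔ (k, d) ≠ (r, c) ∧ (k, d) ∈ P.shape :=
  Finset.mem_erase

theorem IsIncreasing.removeCell {P : Tableau} (hP : P.IsIncreasing) {r c : ℕ}
    (h : P.IsOuter r c) : (P.removeCell r c h).IsIncreasing where
  pos k d hk := hP.pos k d ((mem_removeCell h).1 hk).2
  row_lt k d d' hd hk := hP.row_lt k d d' hd ((mem_removeCell h).1 hk).2
  col_lt k k' d hk hk' := hP.col_lt k k' d hk ((mem_removeCell h).1 hk').2

theorem IsIncreasing.col_removeCell {P : Tableau} (hP : P.IsIncreasing) {r c : ℕ}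
    (h : P.IsOuter r c) :
    (P.removeCell r c h).col = Function.update P.col c (P.col c \ {P.entry r c}) := by
  funext d
  ext y
  by_cases hd : d = c
  · subst hd
    rw [Function.update_self]
    constructor
    · rintro ⟨k, hk, rfl⟩
      obtain ⟨h1, h2⟩ := (mem_removeCell h).1 hk
      refine ⟨⟨k, h2, rfl⟩, fun e => h1 ?_⟩
      rw [hP.row_unique h2 h.mem e]
    · rintro ⟨⟨k, hk, rfl⟩, hne⟩
      refine ⟨k, (mem_removeCell h).2 ⟨fun e => hne ?_, hk⟩, rfl⟩
      rw [(Prod.mk.inj e).1]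
      rfl
  · rw [Function.update_of_ne hd]
    constructor
    · rintro ⟨k, hk, rfl⟩
      exact ⟨k, ((mem_removeCell h).1 hk).2, rfl⟩
    · rintro ⟨k, hk, rfl⟩
      exact ⟨k, (mem_removeCell h).2 ⟨fun e => hd (Prod.mk.inj e).2, hk⟩, rfl⟩

/-! ### The invariant of reverse row insertion -/

/-- The counting functions `tgt` of the left key to be reached, in the columns of index `c` and
`c + 1`, when the smallest element of column `c` outside column `c + 1` is to be removed. -/
def RemovesLeast (P : Tableau) (c : ℕ) (tgt : ℕ → ℕ → ℕ) : Prop :=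
  ∃ n, tailCount (P.col c) 0 = tailCount (P.col (c + 1)) 0 + n + 1 ∧
    tgt c = fun t => min (keyCount P.col c t) (keyCount P.col (c + 1) t + n)

/-- The columns of `T` with the entry of the bumping path in row `i` put back in its column. -/
noncomputable def colWithPath (P : Tableau) (r c i : ℕ) (T : Tableau) : ℕ → Set ℕ :=
  Function.update T.col (P.pathCol r c i)
    (insert (P.entry i (P.pathCol r c i)) (T.col (P.pathCol r c i)))

/-- The invariant of reverse row insertion on `P` at `(r, c)`, after the rows `i, i + 1, …` have
been processed: `T` is the working tableau, `a` the status indicator, and `tgt` gives the counting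
functions of the columns of the left key to be reached. -/
structure IsReverseState (P : Tableau) (r c : ℕ) (tgt : ℕ → ℕ → ℕ) (i : ℕ) (T : Tableau)
    (a : Bool) : Prop where
  inc : T.IsIncreasing
  sub : ∀ k d, (k, d) ∈ T.shape → (k, d) ∈ P.shape
  mem_above : ∀ k d, k < i → (k, d) ∈ P.shape → (k, d) ∈ T.shape
  entry_above : ∀ k d, k < i → T.entry k d = P.entry k d
  path_le : ∀ d, P.pathCol r c i ≤ d → (i, d) ∈ T.shape →
    P.entry i (P.pathCol r c i) ≤ T.entry i d
  -- The first alternative covers a removed cell or a raised entry, the second a dummy row. This is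
  -- used for a direct replacement in the same column one row further up.
  replaced_or : a = true →
    ((i, P.pathCol r c i) ∈ T.shape → P.entry i (P.pathCol r c i) < T.entry i (P.pathCol r c i)) ∨
    ((i, P.pathCol r c i + 1) ∈ P.shape ∧
      P.entry i (P.pathCol r c i + 1) = P.entry i (P.pathCol r c i) + 1)
  key_left : ∀ j, j < P.pathCol r c i → keyCount T.col j = tgt j
  key_idle : a = false → ∀ j, keyCount T.col j = tgt j
  key_right : a = true → ∀ j, P.pathCol r c i < j → keyCount (P.colWithPath r c i T) j = tgt j
  -- Either the path column is right both with and without the path entry, or the path is still in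
  -- the column of the removed cell, which lacks exactly its path entry.
  key_path : a = true →
    (keyCount T.col (P.pathCol r c i) = tgt (P.pathCol r c i) ∧
      keyCount (P.colWithPath r c i T) (P.pathCol r c i) = tgt (P.pathCol r c i)) ∨
    (P.pathCol r c i = c ∧ P.RemovesLeast c tgt ∧ P.entry i c ∈ P.col c ∧
      T.col = Function.update P.col c (P.col c \ {P.entry i c}))

/-- The bumping path leaves no room above row `i` for an entry larger than that of the path in the
column to the right of the path. -/
def PathTight (P : Tableau) (r c i : ℕ) : Prop :=
  ∀ k, k + 1 = i → (k, P.pathCol r c i + 1) ∈ P.shape ∧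
    P.entry k (P.pathCol r c i + 1) ≤ P.entry i (P.pathCol r c i)

namespace IsReverseState

variable {P : Tableau} {r c : ℕ} {tgt : ℕ → ℕ → ℕ} {i : ℕ} {T : Tableau} {a : Bool}

/-- Right of the path, the path entry `m` may be dropped again: by tightness, entries of the next
column above `m` lie in rows `≥ i`, where their left neighbours in `T` also exceed `m`. In the
column of the removed cell, tightness matches all elements below `m` with the next column, so `m` is
the element that the target omits. -/
theorem settled (hs : IsReverseState P r c tgt i T a) (hP : P.IsIncreasing)
    (h : a = true → P.PathTight r c i) (j : ℕ) :
    keyCount T.col j = tgt j := by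
  rcases ha : a with _ | _
  · exact hs.key_idle ha j
  have hE := h ha
  rcases lt_trichotomy j (P.pathCol r c i) with hj | hj | hj
  · exact hs.key_left j hj
  · subst hj
    rcases hs.key_path ha with h1 | ⟨hq, ⟨n, hn, htgt⟩, hm, hcol⟩
    · exact h1.1
    · unfold PathTight at hE
      rw [hq] at hE ⊢
      have hself : T.col c = P.col c \ {P.entry i c} := by rw [hcol, Function.update_self]
      have hsucc : T.col (c + 1) = P.col (c + 1) := by
        rw [hcol, Function.update_of_ne (by omega)]
      have hdom := fun u => hs.inc.countIn_col_succ_le c u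
      rw [hself, hsucc] at hdom
      have h2 : countIn (P.col c) 0 (P.entry i c) ≤
          countIn (P.col (c + 1)) 0 (P.entry i c + 1) := by
        have hrow : ∀ k, (k, c) ∈ P.shape → P.entry k c < P.entry i c →
            (k, c + 1) ∈ P.shape ∧ P.entry k (c + 1) ≤ P.entry i c := fun k hk hlt => by
          have hki : k < i := by
            by_contra hcon
            have := hP.col_le (not_lt.1 hcon) hk
            omega
          obtain ⟨h3, h4⟩ := hE (i - 1) (by omega)
          exact ⟨P.shape.up_left_mem (by omega) le_rfl h3, (hP.col_le (by omega) h3).trans h4⟩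
        refine countIn_le_of_rel
          (fun x y => ∃ k, (k, c + 1) ∈ P.shape ∧ P.entry k c = x ∧ P.entry k (c + 1) = y) ?_ ?_
        · rintro x ⟨k, hk, rfl⟩ _ hx
          obtain ⟨h3, h4⟩ := hrow k hk hx
          exact ⟨_, ⟨k, h3, rfl⟩, Nat.zero_le _, by omega, k, h3, rfl, rfl⟩
        · rintro x x' y ⟨k, h3, rfl, h4⟩ ⟨k', h5, rfl, h6⟩
          rw [hP.row_unique h3 h5 (h4.trans h6.symm)]
      rw [htgt, keyCount, hself,
        tailCount_diff_eq_min (P.col_finite c) (P.col_finite (c + 1)) hm hdom h2 hn,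
        slideAll_congr (B := P.col) fun d _ h3 => by rw [hcol, Function.update_of_ne (by omega)],
        slideAll_min, slideAll_add_const, keyCount_split P.col c 1]
      rfl
  · rw [← hs.key_right ha j hj]
    set q := P.pathCol r c i
    set m := P.entry i q
    by_cases hmq : m ∈ T.col q
    · rw [colWithPath, Set.insert_eq_of_mem hmq, Function.update_eq_self]
    · have hU : T.col = Function.update (P.colWithPath r c i T) q
          (P.colWithPath r c i T q \ {m}) := by
        rw [colWithPath, Function.update_self, Function.update_idem]
        rw [Set.insert_sdiff_self_of_notMem hmq, Function.update_eq_self]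
      have hUne : P.colWithPath r c i T (q + 1) = T.col (q + 1) := by
        rw [colWithPath, Function.update_of_ne (by omega)]
      have hUself : P.colWithPath r c i T q = insert m (T.col q) := by
        rw [colWithPath, Function.update_self]
      rw [hU]
      refine keyCount_diff (fun d => ?_) hj fun u hu => ?_
      · unfold colWithPath
        by_cases hd : d = q
        · subst hd
          rw [Function.update_self]
          exact (T.col_finite _).insert _
        · rw [Function.update_of_ne hd]
          exact T.col_finite d
      · rw [hUne, hUself, countIn_insert_of_lt (by omega)]
        refine countIn_le_of_rel
          (fun x y => ∃ k, (k, q + 1) ∈ T.shape ∧ T.entry k (q + 1) = x ∧ T.entry k q = y) ?_ ?_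
        · rintro x ⟨k, hk, rfl⟩ hmx hxu
          have hk' := T.shape.up_left_mem le_rfl (Nat.le_succ q) hk
          have hik : i ≤ k := by
            by_contra hcon
            obtain ⟨h3, h4⟩ : (i - 1, q + 1) ∈ P.shape ∧ P.entry (i - 1) (q + 1) ≤ m :=
              hE (i - 1) (by omega)
            have h5 := hP.col_le (i := k) (i' := i - 1) (by omega) h3
            rw [hs.entry_above k _ (by omega)] at hmx
            omega
          have h1 : m ≤ T.entry i q := hs.path_le q le_rfl (T.shape.up_left_mem hik le_rfl hk')
          have h2 := hs.inc.col_le hik hk'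
          have h3 : T.entry k q ≠ m := fun e => hmq ⟨k, hk', e⟩
          have h4 := hs.inc.row_lt k q (q + 1) (Nat.lt_succ_self q) hk
          exact ⟨_, ⟨k, hk', rfl⟩, by omega, by omega, k, hk, rfl, rfl⟩
        · rintro x x' y ⟨k, h3, rfl, h4⟩ ⟨k', h5, rfl, h6⟩
          rw [hs.inc.row_unique (T.shape.up_left_mem le_rfl (Nat.le_succ q) h3)
            (T.shape.up_left_mem le_rfl (Nat.le_succ q) h5) (h4.trans h6.symm)]

/-- A row that is left unchanged. -/
theorem of_settled (hinc : T.IsIncreasing) (hsub : ∀ k d, (k, d) ∈ T.shape → (k, d) ∈ P.shape)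
    (hmem : ∀ k d, k ≤ i → (k, d) ∈ P.shape → (k, d) ∈ T.shape)
    (hentry : ∀ k d, k ≤ i → T.entry k d = P.entry k d) (hq : (i, P.pathCol r c i) ∈ P.shape)
    (hset : ∀ j, keyCount T.col j = tgt j)
    (hdummy : a = true → (i, P.pathCol r c i + 1) ∈ P.shape ∧
      P.entry i (P.pathCol r c i + 1) = P.entry i (P.pathCol r c i) + 1) :
    IsReverseState P r c tgt i T a := by
  have hU : P.colWithPath r c i T = T.col := by
    rw [colWithPath, Set.insert_eq_of_mem, Function.update_eq_self]
    exact ⟨i, hmem i _ le_rfl hq, hentry i _ le_rfl⟩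
  refine ⟨hinc, hsub, fun k d hk => hmem k d hk.le, fun k d hk => hentry k d hk.le, ?_,
    fun ha => Or.inr (hdummy ha), fun j _ => hset j, fun _ => hset, ?_, ?_⟩
  · intro d hd hid
    rw [← hentry i _ le_rfl]
    exact hinc.row_le hd hid
  · intro _ j _
    rw [hU, hset]
  · intro _
    left
    rw [hU]
    exact ⟨hset _, hset _⟩

/-- The entry of the path in row `i` is replaced by `x`, coming from a column further left. -/
theorem of_replace (hinc : T.IsIncreasing) (hsub : ∀ k d, (k, d) ∈ T.shape → (k, d) ∈ P.shape)
    (hmem : ∀ k d, k ≤ i → (k, d) ∈ P.shape → (k, d) ∈ T.shape)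
    (hentry : ∀ k d, k ≤ i → T.entry k d = P.entry k d) (hq : (i, P.pathCol r c i) ∈ P.shape)
    (hset : ∀ j, keyCount T.col j = tgt j) {x d₀ : ℕ} (hd₀ : P.pathCol r c i = d₀ + 1)
    (hx : P.entry i (P.pathCol r c i) < x)
    (hright : ∀ d, P.pathCol r c i < d → (i, d) ∈ P.shape → x < P.entry i d)
    (hbelow : (i + 1, P.pathCol r c i) ∈ T.shape → x < T.entry (i + 1) (P.pathCol r c i))
    (hleft : ∀ k, i < k → (k, d₀) ∈ T.shape → x ≤ T.entry k d₀) :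
    IsReverseState P r c tgt i (T.setEntry i (P.pathCol r c i) x) true := by
  have hqT := hmem i _ le_rfl hq
  have hm := hentry i (P.pathCol r c i) le_rfl
  have hinc' : (T.setEntry i (P.pathCol r c i) x).IsIncreasing := by
    refine hinc.setEntry hqT (by rwa [hm]) (fun d hd hid => ?_) hbelow
    rw [hentry i d le_rfl]
    exact hright d hd (hsub _ _ hid)
  have hcol := hinc.col_setEntry (x := x) hqT
  rw [hm] at hcol
  have hmcol : P.entry i (P.pathCol r c i) ∈ T.col (P.pathCol r c i) := ⟨i, hqT, hm⟩
  have hxcol : x ∉ T.col (P.pathCol r c i) := by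
    rintro ⟨k, hk, rfl⟩
    rcases le_or_gt k i with hki | hki
    · have := hinc.col_le hki hqT
      omega
    · have h1 := hbelow (T.shape.up_left_mem hki le_rfl hk)
      have h2 := hinc.col_le (i := i + 1) hki hk
      omega
  -- With the old entry put back, the replacement becomes a plain insertion of `x`.
  have hU : P.colWithPath r c i (T.setEntry i (P.pathCol r c i) x) =
      Function.update T.col (P.pathCol r c i) (insert x (T.col (P.pathCol r c i))) := by
    rw [colWithPath, hcol, Function.update_self, Function.update_idem, Set.insert_comm,
      Set.insert_sdiff_singleton, Set.insert_eq_of_mem hmcol]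
  -- Entries of column `d₀` below `x` lie in rows up to `i`; there the right neighbours are at most
  -- the old path entry, which is less than `x`.
  have hdom : ∀ u, u < x →
      countIn (T.col d₀) u x ≤ countIn (T.col (d₀ + 1)) (u + 1) x := fun u _ => by
    refine countIn_le_of_rel
      (fun x y => ∃ k, (k, d₀ + 1) ∈ T.shape ∧ T.entry k d₀ = x ∧ T.entry k (d₀ + 1) = y) ?_ ?_
    · rintro y ⟨k, hk, rfl⟩ huy hyx
      have hki : k ≤ i := by
        by_contra hcon
        have := hleft k (not_le.1 hcon) hk
        omega
      rw [hd₀] at hqT hm hx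
      have h1 := T.shape.up_left_mem hki le_rfl hqT
      have h2 := hinc.row_lt k d₀ (d₀ + 1) (Nat.lt_succ_self _) h1
      have h3 := hinc.col_le hki hqT
      exact ⟨_, ⟨k, h1, rfl⟩, by omega, by omega, k, h1, rfl, rfl⟩
    · rintro x x' y ⟨k, h3, rfl, h4⟩ ⟨k', h5, rfl, h6⟩
      rw [hinc.row_unique h3 h5 (h4.trans h6.symm)]
  have hins : ∀ j, P.pathCol r c i ≤ j →
      keyCount (P.colWithPath r c i (T.setEntry i (P.pathCol r c i) x)) j = tgt j := by
    intro j hj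
    rw [hU, ← hset j]
    rw [hd₀] at hj ⊢
    exact keyCount_insert T.col_finite hj hdom
  refine ⟨hinc', hsub, fun k d hk => hmem k d hk.le, fun k d hk => ?_, fun d hd hid => ?_,
    fun _ => Or.inl fun _ => ?_, fun j hj => ?_, fun h => (by cases h),
    fun _ j hj => hins j hj.le, fun _ => Or.inl ⟨?_, hins _ le_rfl⟩⟩
  · rw [setEntry_entry_ne T (Or.inl hk.ne), hentry k d hk.le]
  · refine le_trans ?_ (hinc'.row_le hd hid)
    rw [setEntry_entry_self]
    exact hx.le
  · rwa [setEntry_entry_self]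
  · rw [← hset j, hcol]
    exact keyCount_congr fun d hd => Function.update_of_ne (by omega) ..
  · rw [← hset, hcol]
    rw [hd₀] at hx hmcol hxcol ⊢
    exact keyCount_swap T.col_finite hx hmcol hxcol hdom

/-- A direct replacement in the column of the path in the row below. -/
theorem direct_same_column (hs : IsReverseState P r c tgt (i + 1) T true)
    (hq : (i, P.pathCol r c i) ∈ P.shape) (hqq : P.pathCol r c (i + 1) = P.pathCol r c i)
    (hlt : P.entry i (P.pathCol r c i) < P.entry (i + 1) (P.pathCol r c i))
    (hright : ∀ d, P.pathCol r c i < d → (i, d) ∈ P.shape →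
      P.entry (i + 1) (P.pathCol r c i) < P.entry i d)
    (hbelow : (i + 1, P.pathCol r c i) ∈ T.shape →
      P.entry (i + 1) (P.pathCol r c i) < T.entry (i + 1) (P.pathCol r c i)) :
    IsReverseState P r c tgt i
      (T.setEntry i (P.pathCol r c i) (P.entry (i + 1) (P.pathCol r c i))) true := by
  have hU₀ : P.colWithPath r c (i + 1) T = Function.update T.col (P.pathCol r c i)
      (insert (P.entry (i + 1) (P.pathCol r c i)) (T.col (P.pathCol r c i))) := by
    rw [colWithPath, hqq]
  have hkl := hs.key_left
  have hkr := hs.key_right rfl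
  have hkp := hs.key_path rfl
  rw [hqq] at hkl hkr hkp
  set q := P.pathCol r c i
  set m := P.entry i q
  set m' := P.entry (i + 1) q with hm'
  have hqT := hs.mem_above i _ (Nat.lt_succ_self i) hq
  have hm : T.entry i q = m := hs.entry_above i q (Nat.lt_succ_self i)
  have hinc' : (T.setEntry i q m').IsIncreasing := by
    refine hs.inc.setEntry hqT (by rwa [hm]) (fun d hd hid => ?_) hbelow
    rw [hs.entry_above i d (Nat.lt_succ_self i)]
    exact hright d hd (hs.sub _ _ hid)
  have hcol := hs.inc.col_setEntry (x := m') hqT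
  rw [hm] at hcol
  have hmcol : m ∈ T.col q := ⟨i, hqT, hm⟩
  have hxcol : m' ∉ T.col q := by
    rintro ⟨k, hk, he⟩
    rcases le_or_gt k i with hki | hki
    · have := hs.inc.col_le hki hqT
      omega
    · have h1 := hbelow (T.shape.up_left_mem hki le_rfl hk)
      have h2 := hs.inc.col_le (i := i + 1) hki hk
      omega
  -- Both sides are the columns of `T` with `m'` added to column `q`.
  have hU : P.colWithPath r c i (T.setEntry i q m') = P.colWithPath r c (i + 1) T := by
    rw [hU₀, colWithPath, hcol]
    change Function.update (Function.update T.col q (insert m' (T.col q \ {m}))) q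
      (insert m (Function.update T.col q (insert m' (T.col q \ {m})) q)) = _
    rw [Function.update_self, Function.update_idem, Set.insert_comm,
      Set.insert_sdiff_singleton, Set.insert_eq_of_mem hmcol]
  have hne : m' ≠ m := hlt.ne'
  refine ⟨hinc', hs.sub, fun k d hk => hs.mem_above k d (by omega), fun k d hk => ?_,
    fun d hd hid => ?_, fun _ => Or.inl fun _ => ?_, fun j hj => ?_, fun h => (by cases h),
    fun _ j hj => ?_, fun _ => ?_⟩
  · rw [setEntry_entry_ne T (Or.inl hk.ne), hs.entry_above k d (by omega)]
  · refine le_trans ?_ (hinc'.row_le hd hid)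
    change m ≤ _
    rw [setEntry_entry_self]
    exact hlt.le
  · change m < (T.setEntry i q m').entry i q
    rwa [setEntry_entry_self]
  · rw [← hkl j hj, hcol]
    exact keyCount_congr fun d hd => Function.update_of_ne (by omega) ..
  · rw [hU]
    exact hkr j hj
  · rw [hU]
    change (keyCount _ q = tgt q ∧ keyCount _ q = tgt q) ∨ (q = c ∧ _)
    rcases hkp with ⟨h1, h2⟩ | ⟨h1, h2, h3, h4⟩
    · left
      refine ⟨?_, h2⟩
      have hW : T.col q = insert m' (T.col q) \ {m'} :=
        (Set.insert_sdiff_self_of_notMem hxcol).symm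
      have hW' : insert m' (T.col q \ {m}) = insert m' (T.col q) \ {m} :=
        (Set.insert_sdiff_of_notMem _ (by simpa using hne)).symm
      have hfin := (T.col_finite q).insert m'
      -- With `W` the column with `m'` added, the old column is `W \ {m'}` and the new one `W \
      -- {m}`. As `m < m'`, the new counting function lies between those of `W \ {m'}` and `W`, both
      -- of which slide to the target.
      refine funext fun t => le_antisymm ?_ ?_
      · rw [← h2, hU₀, hcol]
        refine keyCount_le_of_last (fun d hd => ?_) (fun t => ?_) t
        · rw [Function.update_of_ne hd.ne, Function.update_of_ne hd.ne]
        · rw [Function.update_self, Function.update_self, hW']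
          exact tailCount_mono hfin fun x hx _ => hx.1
      · rw [← h1, hcol]
        refine keyCount_le_of_last (fun d hd => ?_) (fun t => ?_) t
        · rw [Function.update_of_ne hd.ne]
        · rw [Function.update_self, hW']
          conv_lhs => rw [hW]
          exact tailCount_diff_le hfin (Set.mem_insert _ _) hlt t
    · right
      refine ⟨h1, h2, ?_, ?_⟩
      · rw [← h1]
        exact ⟨i, hq, rfl⟩
      · rw [hcol, h4, ← h1, Function.update_self, Function.update_idem, ← hm']
        congr 1
        -- The gap in the column of the removed cell moves up from `m'` to `m`.
        have h5 : m' ∈ P.col q := by rw [hm', h1]; exact h3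
        change insert m' ((P.col q \ {m'}) \ {m}) = P.col q \ {m}
        ext y
        simp only [Set.mem_insert_iff, Set.mem_sdiff, Set.mem_singleton_iff]
        constructor
        · rintro (rfl | h)
          · exact ⟨h5, hne⟩
          · exact ⟨h.1.1, h.2⟩
        · rintro ⟨h6, h7⟩
          by_cases h8 : y = m'
          · exact Or.inl h8
          · exact Or.inr ⟨⟨h6, h8⟩, h7⟩

end IsReverseState

/-! ### One row of the reverse insertion, and the loop -/

theorem Ejectable.mem_row {P : Tableau} {i x : ℕ} (h : P.Ejectable i x) : x ∈ P.row i := by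
  cases h <;> assumption

/-- In every case with status `true` except a direct replacement straight up a column, row `i` has
an entry, right of the path cell below, that is at most the path entry below. The path is then tight
and `settled` applies. -/
theorem IsReverseState.step {P : Tableau} (hP : P.IsIncreasing) {r c : ℕ}
    (hrc : (r, c) ∈ P.shape) {tgt : ℕ → ℕ → ℕ} {i : ℕ} (hi : i < r) {T : Tableau} {a : Bool}
    (hs : IsReverseState P r c tgt (i + 1) T a) :
    IsReverseState P r c tgt i (P.reverseStep r c i (T, a)).1 (P.reverseStep r c i (T, a)).2 := by
  have hq1 : (i + 1, P.pathCol r c (i + 1)) ∈ P.shape := hP.pathCol_mem hrc hi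
  obtain ⟨hq, hlt, hqq, hmax⟩ := hP.pathCol_step hi hq1
  have hval : P.pathVal r c (i + 1) = (P.entry (i + 1) (P.pathCol r c (i + 1)) : ℕ∞) :=
    if_pos hi
  have hmem : ∀ k d, k ≤ i → (k, d) ∈ P.shape → (k, d) ∈ T.shape := fun k d hk =>
    hs.mem_above k d (by omega)
  have hentry : ∀ k d, k ≤ i → T.entry k d = P.entry k d := fun k d hk =>
    hs.entry_above k d (by omega)
  have hset := hs.settled hP
  have hrowlt : ∀ d, P.pathCol r c (i + 1) < d → (i + 1, d) ∈ T.shape →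
      P.entry (i + 1) (P.pathCol r c (i + 1)) < T.entry (i + 1) d := fun d hd hid =>
    (hs.path_le _ le_rfl (T.shape.up_left_mem le_rfl hd.le hid)).trans_lt
      (hs.inc.row_lt _ _ _ hd hid)
  -- an entry of row `i` to the right of the path and at most that of the path below
  have htight : ∀ d, P.pathCol r c i < d → (i, d) ∈ P.shape →
      P.entry i d ≤ P.entry (i + 1) (P.pathCol r c (i + 1)) → P.PathTight r c (i + 1) := by
    intro d hd hid hle k hk
    obtain rfl : k = i := by omega
    exact ⟨P.shape.up_left_mem le_rfl (by omega) hid, (hP.row_le (by omega) hid).trans hle⟩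
  have hgt : ∀ d, (i, d) ∈ P.shape → P.entry i (P.pathCol r c i) < P.entry i d →
      P.pathCol r c i < d := fun d hid hd => by
    by_contra hcon
    have := hP.row_le (not_lt.1 hcon) hq
    omega
  unfold reverseStep
  dsimp only
  rw [hval]
  split_ifs with h1 h2 h3
  · -- dummy
    obtain ⟨d, hid, hd⟩ := h1
    have hid' := hs.sub _ _ hid
    rw [hentry i d le_rfl] at hd
    have hqd := hgt d hid' (by omega)
    -- The path entry below is larger than `m` and at most `m + 1`, hence equal to the `m + 1` found
    -- in row `i`; this is tightness.
    have h4 := hmax d hqd hid'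
    have h5 := hP.row_lt i _ _ (Nat.lt_succ_self (P.pathCol r c i))
      (P.shape.up_left_mem le_rfl hqd hid')
    have h6 := hP.row_le (c := P.pathCol r c i + 1) hqd hid'
    exact IsReverseState.of_settled hs.inc hs.sub hmem hentry hq
      (hset fun _ => htight d hqd hid' (by omega))
      fun _ => ⟨P.shape.up_left_mem le_rfl hqd hid', by
        simp only [Nat.succ_eq_add_one] at h5; omega⟩
  · -- direct replacement
    obtain ⟨ha, h2⟩ := h2
    subst ha
    rw [ENat.toNat_natCast]
    have hright : ∀ d, P.pathCol r c i < d → (i, d) ∈ P.shape →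
        P.entry (i + 1) (P.pathCol r c (i + 1)) < P.entry i d := fun d hd hid => by
      refine lt_of_le_of_ne (hmax d hd hid) fun e => ?_
      refine h2 (P.entry i d) ⟨d, hmem _ _ le_rfl hid, hentry i d le_rfl⟩ ?_
      rw [e]
    rcases hqq.eq_or_lt with heq | hqlt
    · have hbelow : (i + 1, P.pathCol r c i) ∈ T.shape →
          P.entry (i + 1) (P.pathCol r c i) < T.entry (i + 1) (P.pathCol r c i) := by
        rcases hs.replaced_or rfl with h4 | ⟨h4, h5⟩
        · rwa [heq] at h4
        -- A dummy row below is impossible: the entry above its `m' + 1` would lie strictly between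
        -- `m'` and `m' + 1`.
        · rw [heq] at h4 h5
          have h6 := hright _ (Nat.lt_succ_self _)
            (P.shape.up_left_mem (Nat.le_succ i) le_rfl h4)
          have h7 := hP.col_lt i (i + 1) _ (Nat.lt_succ_self i) h4
          rw [heq] at h6
          simp only [Nat.succ_eq_add_one] at h6
          omega
      rw [heq] at hlt hright ⊢
      exact hs.direct_same_column hq heq hlt hright hbelow
    · obtain ⟨d₀, hd₀⟩ := Nat.exists_eq_add_of_lt hqlt
      have hE : P.PathTight r c (i + 1) := fun k hk => by
        obtain rfl : k = i := by omega
        exact ⟨P.shape.up_left_mem le_rfl hqlt hq, (hP.row_le hqlt hq).trans hlt.le⟩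
      refine IsReverseState.of_replace hs.inc hs.sub hmem hentry hq (hset fun _ => hE) hd₀ hlt
        hright (hrowlt _ hqlt) fun k hk hkd => ?_
      have h4 := T.shape.up_left_mem (i1 := i + 1) hk le_rfl hkd
      exact (hs.path_le _ (by omega) h4).trans (hs.inc.col_le hk hkd)
  all_goals
    -- With status `true`, direct replacement fails only if the path entry below occurs in row `i`,
    -- necessarily to the right of the path.
    have hE : a = true → P.PathTight r c (i + 1) := fun ha => by
      subst ha
      simp only [true_and, not_forall, not_not] at h2
      obtain ⟨_, ⟨d, hid, rfl⟩, hd⟩ := h2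
      have hid' := hs.sub _ _ hid
      rw [hentry i d le_rfl] at hd
      have hd' : P.entry i d = P.entry (i + 1) (P.pathCol r c (i + 1)) := by exact_mod_cast hd
      exact htight d (hgt d hid' (by omega)) hid' hd'.le
  · -- indirect replacement
    obtain ⟨⟨hej, hmx, hxm⟩, _⟩ := h3.choose_spec
    generalize h3.choose = x at hej hmx hxm ⊢
    have hxm' : x < P.entry (i + 1) (P.pathCol r c (i + 1)) := by exact_mod_cast hxm
    obtain ⟨d, hid, hd⟩ := hej.mem_row
    -- Entries of row `i + 1` from the path column on are at least the path entry, so `x` comes from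
    -- further left.
    have hdq : d < P.pathCol r c (i + 1) := by
      by_contra hcon
      have := hs.path_le d (not_lt.1 hcon) hid
      omega
    obtain ⟨d₀, hd₀⟩ : ∃ d₀, P.pathCol r c i = d₀ + 1 :=
      Nat.exists_eq_succ_of_ne_zero (by omega)
    refine IsReverseState.of_replace hs.inc hs.sub hmem hentry hq (hset hE) hd₀ hmx
      (fun e he hie => hxm'.trans_le (hmax e he hie))
      (fun hb => hxm'.trans_le (hs.path_le _ hqq hb)) fun k hk hkd => ?_
    have h4 := T.shape.up_left_mem (i1 := i + 1) hk le_rfl hkd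
    rw [← hd]
    exact (hs.inc.row_le (by omega) h4).trans (hs.inc.col_le hk hkd)
  · -- no replacement
    exact IsReverseState.of_settled hs.inc hs.sub hmem hentry hq (hset hE) fun h => by cases h

theorem IsReverseState.loop {P : Tableau} (hP : P.IsIncreasing) {r c : ℕ}
    (hrc : (r, c) ∈ P.shape) {tgt : ℕ → ℕ → ℕ} {i : ℕ} (hi : i ≤ r) {s : Tableau × Bool}
    (hs : IsReverseState P r c tgt i s.1 s.2) :
    (P.reverseLoop r c i s).1.IsIncreasing ∧
      ∀ j, keyCount (P.reverseLoop r c i s).1.col j = tgt j := by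
  induction i generalizing s with
  | zero =>
    -- No row lies above row `0`, so tightness is vacuous.
    exact ⟨hs.inc, hs.settled hP fun _ k hk => by omega⟩
  | succ i ih =>
    obtain ⟨T, a⟩ := s
    exact ih (by omega) (hs.step hP hrc hi)

/-! ### The initial states for the two flags -/

theorem IsIncreasing.isReverseState_removeCell {P : Tableau} (hP : P.IsIncreasing) {r c : ℕ}
    (h : P.IsOuter r c) {tgt : ℕ → ℕ → ℕ} (hc : P.RemovesLeast c tgt)
    (htgt : ∀ j, j ≠ c → keyCount P.col j = tgt j) :
    IsReverseState P r c tgt r (P.removeCell r c h) true := by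
  have hcol := hP.col_removeCell h
  have hm : P.entry r c ∈ P.col c := ⟨r, h.mem, rfl⟩
  have hself : (P.removeCell r c h).col c = P.col c \ {P.entry r c} := by
    rw [hcol, Function.update_self]
  have hU : P.colWithPath r c r (P.removeCell r c h) = P.col := by
    rw [colWithPath, pathCol_self, hself, Set.insert_sdiff_singleton, Set.insert_eq_of_mem hm, hcol,
      Function.update_idem, Function.update_eq_self]
  refine ⟨hP.removeCell h, fun k d hk => ((mem_removeCell h).1 hk).2, fun k d hk hkd => ?_,
    fun _ _ _ => rfl, ?_, ?_, ?_, fun h => (by cases h), ?_, ?_⟩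
  · refine (mem_removeCell h).2 ⟨fun e => ?_, hkd⟩
    have := (Prod.mk.inj e).1
    omega
  · intro d hd hrd
    rw [pathCol_self] at hd
    exact hP.row_le (by rwa [pathCol_self]) ((mem_removeCell h).1 hrd).2
  · intro _
    left
    rw [pathCol_self]
    exact fun hmem => absurd rfl ((mem_removeCell h).1 hmem).1
  · intro j hj
    rw [pathCol_self] at hj
    rw [← htgt j hj.ne, hcol]
    exact keyCount_congr fun d hd => Function.update_of_ne (by omega) ..
  · intro _ j hj
    rw [pathCol_self] at hj
    rw [hU, htgt j hj.ne']
  · intro _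
    exact Or.inr ⟨pathCol_self P r c, hc, hm, hcol⟩

/-- Row `r` has no path entry below it, so it is treated separately. An ejectable value comes from
row `r + 1`, hence from a column left of `c`, since `(r, c)` is outer. -/
theorem IsIncreasing.isReverseState_reverseStep {P : Tableau} (hP : P.IsIncreasing) {r c : ℕ}
    (h : P.IsOuter r c) :
    IsReverseState P r c (keyCount P.col) r (P.reverseStep r c r (P, false)).1
      (P.reverseStep r c r (P, false)).2 := by
  have hq : (r, P.pathCol r c r) ∈ P.shape := by rw [pathCol_self]; exact h.mem
  unfold reverseStep
  dsimp only
  split_ifs with h1 h2 h3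
  · exfalso
    obtain ⟨d, hd, he⟩ := h1
    rw [pathCol_self] at he
    rcases le_or_gt d c with hdc | hdc
    · have := hP.row_le hdc h.mem
      omega
    · exact h.right (P.shape.up_left_mem le_rfl hdc hd)
  · cases h2.1
  · obtain ⟨⟨hej, hmx, _⟩, _⟩ := h3.choose_spec
    generalize h3.choose = x at hej hmx ⊢
    obtain ⟨d, hid, hd⟩ := hej.mem_row
    have hdc : d < c := by
      by_contra hcon
      exact h.below (P.shape.up_left_mem le_rfl (not_lt.1 hcon) hid)
    refine IsReverseState.of_replace (d₀ := c - 1) hP (fun _ _ => id) (fun _ _ _ => id)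
      (fun _ _ _ => rfl) hq (fun _ => rfl) ?_ hmx ?_ ?_ ?_
    · rw [pathCol_self]; omega
    · intro e he hre
      rw [pathCol_self] at he
      exact absurd (P.shape.up_left_mem le_rfl he hre) h.right
    · intro hb
      rw [pathCol_self] at hb
      exact absurd hb h.below
    · intro k hk hkd
      rw [← hd]
      exact (hP.row_le (by omega) (P.shape.up_left_mem (i1 := r + 1) hk le_rfl hkd)).trans
        (hP.col_le hk hkd)
  · exact IsReverseState.of_settled hP (fun _ _ => id) (fun _ _ _ => id) (fun _ _ _ => rfl) hq
      (fun _ => rfl) fun h => by cases h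

end Tableau

/-! ### Proof of the theorem -/

theorem theorem6p8 (P : Tableau) (hP : P.IsIncreasing) (R C : ℕ) (hRC : P.IsOuter R C)
    (α : Bool) (P' : Tableau) (m : ℕ) (hout : P.reverseInsert R C hRC α = (P', m)) :
    P'.IsIncreasing ∧
    (α = false → ∀ j, P'.leftKey j = P.leftKey j) ∧
    (α = true →
      (∀ j, j ≠ C → P'.leftKey j = P.leftKey j) ∧
      ∃ y, IsLeast (P.leftKey C \ P.leftKey (C + 1)) y ∧
        P'.leftKey C = P.leftKey C \ {y}) := by
  have hP' := congrArg Prod.fst hout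
  cases α with
  | false =>
    obtain ⟨h1, h2⟩ := Tableau.IsReverseState.loop hP hRC.mem le_rfl
      (hP.isReverseState_reverseStep hRC)
    change (P.reverseLoop R C R (P.reverseStep R C R (P, false))).1 = P' at hP'
    rw [hP'] at h1 h2
    refine ⟨h1, fun _ j => ?_, fun h => by cases h⟩
    rw [h1.leftKey_eq, hP.leftKey_eq, h2]
  | true =>
    change (P.reverseLoop R C R (P.removeCell R C hRC, true)).1 = P' at hP'
    -- Without the cell the tableau is still increasing, so column `C + 1` is matched into the
    -- shortened column `C`. Hence column `C` of `P` is strictly longer, by `n + 1`.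
    have hdom := fun u => (hP.removeCell hRC).countIn_col_succ_le C u
    rw [hP.col_removeCell hRC, Function.update_self, Function.update_of_ne (by omega)] at hdom
    obtain ⟨n, hn⟩ := Nat.exists_eq_add_of_lt (Tableau.tailCount_lt_of_dominated (P.col_finite C)
      (P.col_finite (C + 1)) ⟨R, hRC.mem, rfl⟩ hdom)
    set tgt : ℕ → ℕ → ℕ := Function.update (Tableau.keyCount P.col) C
      fun t => min (Tableau.keyCount P.col C t) (Tableau.keyCount P.col (C + 1) t + n)
    have hself := Function.update_self C
      (fun t => min (Tableau.keyCount P.col C t) (Tableau.keyCount P.col (C + 1) t + n))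
      (Tableau.keyCount P.col)
    have hne : ∀ j, j ≠ C → Tableau.keyCount P.col j = tgt j := fun j hj =>
      (Function.update_of_ne hj ..).symm
    obtain ⟨h1, h2⟩ := Tableau.IsReverseState.loop (s := (P.removeCell R C hRC, true)) hP
      hRC.mem le_rfl
      (hP.isReverseState_removeCell hRC ⟨n, hn, hself⟩ hne)
    rw [hP'] at h1 h2
    refine ⟨h1, fun h => (by cases h), fun _ => ⟨fun j hj => ?_, ?_⟩⟩
    · rw [h1.leftKey_eq, hP.leftKey_eq, h2, hne j hj]
    · obtain ⟨y, hy, hy'⟩ := hP.exists_isLeast_leftKey hn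
      refine ⟨y, hy, ?_⟩
      rw [h1.leftKey_eq, h2, hself, hy']
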